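/- \textbf{Theorem.} Let $n\ge 0$, let $(\bar M,\bar g)$ be a smooth Lorentzian manifold of dimension $n+2$ with Levi-Civita connection $\bar\nabla$, and let $M$ be a smooth $(n+1)$-manifold immersed in $\bar M$ such that the induced metric $g$ is degenerate at every point, that is, $\mathrm{rad}(T_pM)=T_pM\cap T_pM^\perp\neq 0$ for all $p\in M$. Let $Z$ be a smooth vector field on $\bar M$ that is closed and conformal, i.e. there is $\varphi\in C^\infty(\bar M)$ with $\bar\nabla_XZ=\varphi X$ for all $X$, and suppose that $\bar g(Z,Z)$ vanishes nowhere and that $Z$ is nowhere tangent to $M$. Then the sum $\mathrm{span}(Z)+\mathrm{rad}(TM)$ is direct along $M$, its orthogonal complement $$S'(TM)=(\mathrm{span}(Z)\oplus\mathrm{rad}(TM))^\perp$$ is contained in $TM$ and is a screen distribution, i.e. a smooth subbundle of $TM$ with $TM=S'(TM)\oplus\mathrm{rad}(TM)$, and $(M,g,S'(TM))$ is screen quasi-conformal. Furthermore, there is a null frame $(\xi,N)$ of $(M,g,S'(TM))$, with $Z=\xi+\tfrac12\bar g(Z,Z)N$ along $M$, for which $\tau(X)=0$ for all $X\in S'(TM)$.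 Here a \emph{null frame} for a screen distribution $S(TM)$ consists of a smooth nowhere zero section $\xi$ of $\mathrm{rad}(TM)$ and a smooth vector field $N$ along $M$ with values in $T\bar M$ such that $\bar g(\xi,N)=1$, $\bar g(N,N)=0$ and $\bar g(N,X)=0$ for all $X\in S(TM)$; then $T\bar M=TM\oplus\mathrm{span}(N)$ along $M$. Let $P:TM\to S(TM)$ be the projection along $\mathrm{rad}(TM)$. The connection $\nabla$, the shape operators $A_N$ and $A^*_\xi$ and the one-form $\tau$ are defined by the decompositions $\bar\nabla_XY=\nabla_XY+h(X,Y)$ and $\bar\nabla_XN=-A_NX+\nabla^t_XN$, with $\nabla_XY,A_NX\in TM$ and $h(X,Y),\nabla^t_XN\in\mathrm{span}(N)$, by $A^*_\xi X=-P(\nabla_X\xi)$, and by $\tau(X)=\bar g(\nabla^t_XN,\xi)$. \emph{Screen quasi-conformal} means that null frames exist and that for every null frame $(\xi,N)$ there are $\phi,\psi\in C^\infty(M)$ with $A_N=\phi A^*_\xi+\psi P$. -/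

import Mathlib

open scoped Manifold ContDiff

noncomputable section

/-- A smooth Lorentzian metric on a smooth manifold `N` of dimension `m`: a smooth symmetric
`(0,2)`-tensor field of signature `(-,+,…,+)` at every point. -/
structure LorentzianMetric (m : ℕ) (N : Type*) [TopologicalSpace N]
    [ChartedSpace (EuclideanSpace ℝ (Fin m)) N] [IsManifold (𝓡 m) ∞ N] where
  /-- The scalar product on each tangent space. -/
  inner (x : N) : TangentSpace (𝓡 m) x →L[ℝ] TangentSpace (𝓡 m) x →L[ℝ] ℝ
  symm (x : N) (v w : TangentSpace (𝓡 m) x) : inner x v w = inner x w v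
  /-- There is a timelike vector whose orthogonal complement is positive definite. -/
  signature (x : N) : ∃ t : TangentSpace (𝓡 m) x, inner x t t < 0 ∧
    ∀ v : TangentSpace (𝓡 m) x, inner x t v = 0 → v ≠ 0 → 0 < inner x v v
  contMDiff : ContMDiff (𝓡 m)
    ((𝓡 m).prod 𝓘(ℝ, EuclideanSpace ℝ (Fin m) →L[ℝ] EuclideanSpace ℝ (Fin m) →L[ℝ] ℝ)) ∞
    (fun x ↦ Bundle.TotalSpace.mk'
      (EuclideanSpace ℝ (Fin m) →L[ℝ] EuclideanSpace ℝ (Fin m) →L[ℝ] ℝ)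
      (E := fun x ↦ TangentSpace (𝓡 m) x →L[ℝ] TangentSpace (𝓡 m) x →L[ℝ] ℝ) x (inner x))

namespace LorentzianMetric

section Connection

variable {m : ℕ} {N : Type*} [TopologicalSpace N]
  [ChartedSpace (EuclideanSpace ℝ (Fin m)) N] [IsManifold (𝓡 m) ∞ N]

/-- The metric at `x` as a bilinear form. -/
def form (g : LorentzianMetric m N) (x : N) : LinearMap.BilinForm ℝ (TangentSpace (𝓡 m) x) :=
  (g.inner x).toBilinForm

theorem form_nondegenerate (g : LorentzianMetric m N) (x : N) : (g.form x).Nondegenerate := by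
  obtain ⟨t, -, ht⟩ := g.signature x
  constructor
  · intro v hv
    by_contra h
    have h1 : g.inner x v v = 0 := hv v
    have h2 : g.inner x t v = 0 := by rw [g.symm]; exact hv t
    exact absurd h1 (ht v h2 h).ne'
  · intro v hv
    by_contra h
    have h1 : g.inner x v v = 0 := hv v
    exact absurd h1 (ht v (hv t) h).ne'

instance finiteDimensional_tangentSpace (x : N) :
    FiniteDimensional ℝ (TangentSpace (𝓡 m) x) :=
  inferInstanceAs (FiniteDimensional ℝ (EuclideanSpace ℝ (Fin m)))

/-- The components `(g_{ij})` of the metric at the point `x`, in the coordinates of the preferred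
chart at `y`, as a bilinear form on the model space. -/
def chartMetric (g : LorentzianMetric m N) (y x : N) :
    EuclideanSpace ℝ (Fin m) →L[ℝ] EuclideanSpace ℝ (Fin m) →L[ℝ] ℝ :=
  let e := trivializationAt (EuclideanSpace ℝ (Fin m)) (TangentSpace (𝓡 m) : N → Type _) y
  (ContinuousLinearMap.precomp ℝ (e.symmL ℝ x)).comp ((g.inner x).comp (e.symmL ℝ x))

theorem chartMetric_apply (g : LorentzianMetric m N) (y x : N) (v w : EuclideanSpace ℝ (Fin m)) :
    g.chartMetric y x v w =
      let e := trivializationAt (EuclideanSpace ℝ (Fin m)) (TangentSpace (𝓡 m) : N → Type _) y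
      g.inner x (e.symmL ℝ x v) (e.symmL ℝ x w) := rfl

/-- `dChartMetric g y u v w = ∂_u (g(∂_v, ∂_w))` at `y`, where `∂_v` denotes the
vector field with constant components `v` in the preferred chart at `y`. The tangent space at `y`
is by definition the model space, through that chart. -/
def dChartMetric (g : LorentzianMetric m N) (y : N) : EuclideanSpace ℝ (Fin m) →L[ℝ]
    EuclideanSpace ℝ (Fin m) →L[ℝ] EuclideanSpace ℝ (Fin m) →L[ℝ] ℝ :=
  mvfderiv (𝓡 m) (g.chartMetric y) y

/-- The Christoffel symbol `Γ(u, v)` of the Levi-Civita connection at `y`, in the preferred chart at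
`y`: the vector determined by
`2 g(Γ(u,v), w) = ∂_u g(v,w) + ∂_v g(u,w) - ∂_w g(u,v)` for all `w`. -/
def christoffel (g : LorentzianMetric m N) (y : N) (u v : TangentSpace (𝓡 m) y) :
    TangentSpace (𝓡 m) y :=
  ((g.form y).toDual (g.form_nondegenerate y)).symm
    ((1 / 2 : ℝ) • (g.dChartMetric y u v + g.dChartMetric y v u
      - ((g.dChartMetric y).flip u).flip v).toLinearMap)

theorem inner_christoffel (g : LorentzianMetric m N) (y : N) (u v w : TangentSpace (𝓡 m) y) :
    g.inner y (g.christoffel y u v) w = 1 / 2 * (g.dChartMetric y u v w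
      + g.dChartMetric y v u w - g.dChartMetric y w u v) :=
  LinearMap.BilinForm.apply_toDual_symm_apply (hB := g.form_nondegenerate y)
    ((1 / 2 : ℝ) • (g.dChartMetric y u v + g.dChartMetric y v u
      - ((g.dChartMetric y).flip u).flip v).toLinearMap) w

end Connection

section Immersion

variable {m k : ℕ} {N : Type*} [TopologicalSpace N]
  [ChartedSpace (EuclideanSpace ℝ (Fin m)) N] [IsManifold (𝓡 m) ∞ N]
  {M : Type*} [TopologicalSpace M] [ChartedSpace (EuclideanSpace ℝ (Fin k)) M]

/-- The Levi-Civita covariant derivative `∇̄_X V` at `p`, where `V` is a vector field along the map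
`f : M → N` and `X` is a tangent vector of `M` at `p`. In the preferred chart at `f p` it is
`dV(X) + Γ(df(X), V)`, where `dV` is the derivative of the components of `V`. -/
def covAlong (g : LorentzianMetric m N) (f : M → N) (V : ∀ p, TangentSpace (𝓡 m) (f p))
    (p : M) (X : TangentSpace (𝓡 k) p) : TangentSpace (𝓡 m) (f p) :=
  let dV : TangentSpace (𝓡 m) (f p) := mvfderiv (𝓡 k) (fun q ↦
    (trivializationAt (EuclideanSpace ℝ (Fin m)) (TangentSpace (𝓡 m) : N → Type _) (f p)
      ⟨f q, V q⟩).2) p X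
  dV + g.christoffel (f p) (mfderiv (𝓡 k) (𝓡 m) f p X) (V p)

/-- The Levi-Civita covariant derivative `∇̄_X V` of a vector field on the manifold itself. -/
def cov (g : LorentzianMetric m N) (V : ∀ x : N, TangentSpace (𝓡 m) x)
    (x : N) (X : TangentSpace (𝓡 m) x) : TangentSpace (𝓡 m) x :=
  g.covAlong (k := m) id V x X

/-- `Z` is a closed conformal vector field: `Z` is smooth and there is a smooth function `φ` with
`∇̄_X Z = φ X` for all `X`. -/
def IsClosedConformal (g : LorentzianMetric m N) (Z : ∀ x : N, TangentSpace (𝓡 m) x) : Prop :=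
  ContMDiff (𝓡 m) (𝓡 m).tangent ∞ (fun x ↦ (⟨x, Z x⟩ : TangentBundle (𝓡 m) N)) ∧
  ∃ φ : N → ℝ, ContMDiff (𝓡 m) 𝓘(ℝ) ∞ φ ∧
    ∀ (x : N) (X : TangentSpace (𝓡 m) x), g.cov Z x X = φ x • X

/-- The radical `rad(T_pM)` of the metric induced by `f`:
the tangent vectors that are orthogonal to all tangent vectors. -/
def rad (g : LorentzianMetric m N) (f : M → N) (p : M) : Submodule ℝ (TangentSpace (𝓡 k) p) :=
  ((g.form (f p)).orthogonal (LinearMap.range (mfderiv (𝓡 k) (𝓡 m) f p).toLinearMap)).comap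
    (mfderiv (𝓡 k) (𝓡 m) f p).toLinearMap

/-- `f` is a smooth immersion of `M` in `N`, as a hypersurface,
and the metric it induces on `M` is degenerate at every point. -/
structure IsDegenerateHypersurface (g : LorentzianMetric m N) (f : M → N) : Prop where
  codim : m = k + 1
  contMDiff : ContMDiff (𝓡 k) (𝓡 m) ∞ f
  injective (p : M) : Function.Injective (mfderiv (𝓡 k) (𝓡 m) f p)
  degenerate (p : M) : g.rad (k := k) f p ≠ ⊥

variable [IsManifold (𝓡 k) ∞ M]

/-- The family of subspaces `S p ⊆ T_pM` is a smooth vector subbundle of `TM`: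
near every point it is spanned by a smooth frame. -/
def _root_.IsSmoothDistribution (S : ∀ p : M, Submodule ℝ (TangentSpace (𝓡 k) p)) : Prop :=
  ∀ p : M, ∃ U : Set M, IsOpen U ∧ p ∈ U ∧
    ∃ (r : ℕ) (s : Fin r → ∀ q : M, TangentSpace (𝓡 k) q),
      (∀ i, ContMDiffOn (𝓡 k) (𝓡 k).tangent ∞
        (fun q ↦ (⟨q, s i q⟩ : TangentBundle (𝓡 k) M)) U) ∧
      ∀ q ∈ U, LinearIndependent ℝ (fun i ↦ s i q) ∧
        Submodule.span ℝ (Set.range fun i ↦ s i q) = S q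

/-- `S` is a screen distribution: a vector subbundle of `TM` with `TM = S ⊕ rad(TM)`
(the sum is automatically orthogonal). -/
def IsScreen (g : LorentzianMetric m N) (f : M → N)
    (S : ∀ p : M, Submodule ℝ (TangentSpace (𝓡 k) p)) : Prop :=
  IsSmoothDistribution S ∧ ∀ p, IsCompl (S p) (g.rad f p)

/-- `ξ` is a smooth nowhere zero section of `rad(TM)`, and `ν` is the smooth section of the
transversal bundle of the screen distribution `S` that is associated with `ξ`:
`ḡ(ξ,ν) = 1`, `ḡ(ν,ν) = 0` and `ḡ(ν,X) = 0` for all `X` in `S`. -/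
structure IsNullFrame (g : LorentzianMetric m N) (f : M → N)
    (S : ∀ p : M, Submodule ℝ (TangentSpace (𝓡 k) p))
    (ξ : ∀ p : M, TangentSpace (𝓡 k) p) (ν : ∀ p : M, TangentSpace (𝓡 m) (f p)) : Prop where
  contMDiff_rad : ContMDiff (𝓡 k) (𝓡 k).tangent ∞
    (fun p ↦ (⟨p, ξ p⟩ : TangentBundle (𝓡 k) M))
  contMDiff_transversal : ContMDiff (𝓡 k) (𝓡 m).tangent ∞
    (fun p ↦ (⟨f p, ν p⟩ : TangentBundle (𝓡 m) N))
  mem_rad (p : M) : ξ p ∈ g.rad f p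
  ne_zero (p : M) : ξ p ≠ 0
  inner_eq_one (p : M) : g.inner (f p) (mfderiv (𝓡 k) (𝓡 m) f p (ξ p)) (ν p) = 1
  inner_self (p : M) : g.inner (f p) (ν p) (ν p) = 0
  inner_screen (p : M) (X : TangentSpace (𝓡 k) p) (hX : X ∈ S p) :
    g.inner (f p) (ν p) (mfderiv (𝓡 k) (𝓡 m) f p X) = 0

/-- The `T_pM`-component of `W ∈ T_{f(p)}N` in the decomposition `T_{f(p)}N = T_pM ⊕ span(ν_p)`. -/
def tangentPart (f : M → N) (ν : ∀ p : M, TangentSpace (𝓡 m) (f p)) (p : M)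
    (W : TangentSpace (𝓡 m) (f p)) : TangentSpace (𝓡 k) p :=
  Classical.epsilon fun Y ↦
    W - mfderiv (𝓡 k) (𝓡 m) f p Y ∈ Submodule.span ℝ {ν p}

/-- The `tr(TM)`-component of `W ∈ T_{f(p)}N` in the decomposition
`T_{f(p)}N = T_pM ⊕ span(ν_p)`. -/
def transversalPart (f : M → N) (ν : ∀ p : M, TangentSpace (𝓡 m) (f p)) (p : M)
    (W : TangentSpace (𝓡 m) (f p)) : TangentSpace (𝓡 m) (f p) :=
  W - mfderiv (𝓡 k) (𝓡 m) f p (tangentPart (k := k) f ν p W)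

/-- The projection `P : T_pM → S_p` along `rad(T_pM)`. -/
def screenProj (g : LorentzianMetric m N) (f : M → N)
    (S : ∀ p : M, Submodule ℝ (TangentSpace (𝓡 k) p)) (p : M) (X : TangentSpace (𝓡 k) p) :
    TangentSpace (𝓡 k) p :=
  Classical.epsilon fun Y ↦ Y ∈ S p ∧ X - Y ∈ g.rad f p

/-- The induced connection: `∇_X Y` is the tangential component of `∇̄_X Y`. -/
def inducedCov (g : LorentzianMetric m N) (f : M → N) (ν : ∀ p : M, TangentSpace (𝓡 m) (f p))
    (Y : ∀ p : M, TangentSpace (𝓡 k) p) (p : M) (X : TangentSpace (𝓡 k) p) :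
    TangentSpace (𝓡 k) p :=
  tangentPart f ν p (g.covAlong f (fun q ↦ mfderiv (𝓡 k) (𝓡 m) f q (Y q)) p X)

/-- The shape operator `A_ν` of `M`, from `∇̄_X ν = -A_ν X + ∇ᵗ_X ν`. -/
def shapeOp (g : LorentzianMetric m N) (f : M → N) (ν : ∀ p : M, TangentSpace (𝓡 m) (f p))
    (p : M) (X : TangentSpace (𝓡 k) p) : TangentSpace (𝓡 k) p :=
  -tangentPart f ν p (g.covAlong f ν p X)

/-- The screen shape operator `A*_ξ`, from `∇_X ξ = -A*_ξ X + ∇*ᵗ_X ξ`,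
with `A*_ξ X` in `S` and `∇*ᵗ_X ξ` in `rad(TM)`. -/
def screenShapeOp (g : LorentzianMetric m N) (f : M → N)
    (S : ∀ p : M, Submodule ℝ (TangentSpace (𝓡 k) p)) (ν : ∀ p : M, TangentSpace (𝓡 m) (f p))
    (ξ : ∀ p : M, TangentSpace (𝓡 k) p) (p : M) (X : TangentSpace (𝓡 k) p) :
    TangentSpace (𝓡 k) p :=
  -g.screenProj f S p (g.inducedCov f ν ξ p X)

/-- The one-form `τ(X) = ḡ(∇ᵗ_X ν, ξ)`, where `∇ᵗ_X ν` is the transversal component of `∇̄_X ν`. -/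
def tau (g : LorentzianMetric m N) (f : M → N) (ξ : ∀ p : M, TangentSpace (𝓡 k) p)
    (ν : ∀ p : M, TangentSpace (𝓡 m) (f p)) (p : M) (X : TangentSpace (𝓡 k) p) : ℝ :=
  g.inner (f p) (transversalPart (k := k) f ν p (g.covAlong f ν p X)) (mfderiv (𝓡 k) (𝓡 m) f p (ξ p))

/-- `(M, g, S)` is screen quasi-conformal: there are null frames `(ξ, ν)`, and for each of them
there are smooth functions `φ, ψ` on `M` with `A_ν = φ A*_ξ + ψ P`. -/
def IsScreenQuasiConformal (g : LorentzianMetric m N) (f : M → N)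
    (S : ∀ p : M, Submodule ℝ (TangentSpace (𝓡 k) p)) : Prop :=
  (∃ (ξ : ∀ p : M, TangentSpace (𝓡 k) p) (ν : ∀ p : M, TangentSpace (𝓡 m) (f p)),
    g.IsNullFrame f S ξ ν) ∧
  ∀ (ξ : ∀ p : M, TangentSpace (𝓡 k) p) (ν : ∀ p : M, TangentSpace (𝓡 m) (f p)),
    g.IsNullFrame f S ξ ν →
    ∃ φ ψ : M → ℝ, ContMDiff (𝓡 k) 𝓘(ℝ) ∞ φ ∧ ContMDiff (𝓡 k) 𝓘(ℝ) ∞ ψ ∧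
      ∀ (p : M) (X : TangentSpace (𝓡 k) p),
        g.shapeOp f ν p X = φ p • g.screenShapeOp f S ν ξ p X + ψ p • g.screenProj f S p X

/-- The bundle `E = span(Z) + rad(TM)` along `M`, as a family of subspaces of `T_{f(p)}N`. -/
def spanSupRad (g : LorentzianMetric m N) (f : M → N) (Z : ∀ x : N, TangentSpace (𝓡 m) x)
    (p : M) : Submodule ℝ (TangentSpace (𝓡 m) (f p)) :=
  Submodule.span ℝ {Z (f p)} ⊔
    (g.rad (k := k) f p).map (mfderiv (𝓡 k) (𝓡 m) f p).toLinearMap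

/-- The distribution `(span(Z) + rad(TM))^⊥`, as a family of subspaces of `T_pM`. -/
def screenOf (g : LorentzianMetric m N) (f : M → N) (Z : ∀ x : N, TangentSpace (𝓡 m) x)
    (p : M) : Submodule ℝ (TangentSpace (𝓡 k) p) :=
  ((g.form (f p)).orthogonal (g.spanSupRad (k := k) f Z p)).comap
    (mfderiv (𝓡 k) (𝓡 m) f p).toLinearMap

end Immersion

end LorentzianMetric

end

/-! Since `M` has codimension one and `Z` is transversal, `T_{f(p)}N = T_pM ⊕ span(Z)`. A vector of
the radical orthogonal to `Z` would be orthogonal to everything, so pairing with `Z` is injective on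
the radical. Hence the radical is a line, its orthogonal complement is `T_pM`, and the proposed
screen is the kernel of `ḡ(Z,·)` on `T_pM`, complementary to the radical.

With `θ = ḡ(Z,Z)/2`, which has no zeros, let `ξ` be the radical section with `ḡ(ξ,Z) = θ` and put `ν
= (Z - ξ)/θ`; this is the required null frame. Smoothness of `ξ` comes from viewing it as the unique
solution of a smooth family of invertible linear equations (`contMDiff_of_mem_rad`).

For an arbitrary null frame, `Z = aξ + bν` along `M` with `b = ḡ(Z,ξ)` nowhere zero
(`eq_smul_add_smul`). Metric compatibility (`mvfderiv_inner`) makes `∇̄_X ξ` tangent to `M`, because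
`ḡ(ξ,ξ) = 0`, and puts the tangential part of `∇̄_X ν` in the screen, because `ḡ(ν,ν) = 0`.
Differentiating the decomposition and using `∇̄_X Z = φX` (`structure_eq`) gives `φX = a ∇_X ξ +
X(a) ξ - b A_ν X` and `X(b) + b τ(X) = 0`. Projecting the first equation to the screen yields `A_ν =
-(a/b) A*_ξ - (φ/b) P`. In the special frame `b = θ` and `X(θ) = φ ḡ(X,Z)`, which vanishes on the
screen, so the second equation gives `τ = 0` there. -/

namespace LorentzianMetric

set_option linter.unusedSectionVars false

/-! ### Calculus of vector fields along a map and metric compatibility -/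

section Calculus

variable {m k : ℕ} {N : Type*} [TopologicalSpace N]
  [ChartedSpace (EuclideanSpace ℝ (Fin m)) N] [IsManifold (𝓡 m) ∞ N]
  {M : Type*} [TopologicalSpace M] [ChartedSpace (EuclideanSpace ℝ (Fin k)) M]

/-- Smoothness at `p` of a vector field along the map `f`. -/
def SmoothAlongAt (f : M → N) (V : ∀ p, TangentSpace (𝓡 m) (f p)) (p : M) : Prop :=
  ContMDiffAt (𝓡 k) (𝓡 m).tangent ∞ (fun p ↦ (⟨f p, V p⟩ : TangentBundle (𝓡 m) N)) p

/-- Smoothness of a vector field along the map `f`. -/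
def SmoothAlong (f : M → N) (V : ∀ p, TangentSpace (𝓡 m) (f p)) : Prop :=
  ∀ p, SmoothAlongAt (k := k) f V p

/-- The components, in the preferred chart at `y`, of a vector field along `f`. -/
noncomputable def comps (f : M → N) (V : ∀ p, TangentSpace (𝓡 m) (f p)) (y : N) (q : M) :
    EuclideanSpace ℝ (Fin m) :=
  (trivializationAt (EuclideanSpace ℝ (Fin m)) (TangentSpace (𝓡 m) : N → Type _) y ⟨f q, V q⟩).2

/-- `covAlong` at `p` uses only the chart centred at `f p`, where components and vectors coincide at
the centre. Each identity is therefore checked in that one chart, without any change of coordinates.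
-/
theorem comps_self (f : M → N) (V : ∀ p, TangentSpace (𝓡 m) (f p)) (p : M) :
    comps f V (f p) p = V p :=
  (tangentBundleCore (𝓡 m) N).coordChange_self _ _ (mem_chart_source _ _) _

theorem symmL_self (y : N) (v : EuclideanSpace ℝ (Fin m)) :
    (trivializationAt (EuclideanSpace ℝ (Fin m))
      (TangentSpace (𝓡 m) : N → Type _) y).symmL ℝ y v = v := by
  rw [TangentBundle.symmL_trivializationAt_eq_core (mem_chart_source _ _)]
  exact (tangentBundleCore (𝓡 m) N).coordChange_self _ _ (mem_chart_source _ _) _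

theorem contMDiffAt_iff_comps {f : M → N} {V : ∀ p, TangentSpace (𝓡 m) (f p)} {p : M} :
    ContMDiffAt (𝓡 k) (𝓡 m).tangent ∞ (fun p ↦ (⟨f p, V p⟩ : TangentBundle (𝓡 m) N)) p ↔
    ContMDiffAt (𝓡 k) (𝓡 m) ∞ f p ∧
      ContMDiffAt (𝓡 k) 𝓘(ℝ, EuclideanSpace ℝ (Fin m)) ∞ (comps f V (f p)) p :=
  Bundle.contMDiffAt_totalSpace

theorem SmoothAlongAt.base {f : M → N} {V : ∀ p, TangentSpace (𝓡 m) (f p)} {p : M}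
    (hV : SmoothAlongAt (k := k) f V p) : ContMDiffAt (𝓡 k) (𝓡 m) ∞ f p :=
  (contMDiffAt_iff_comps.1 hV).1

theorem SmoothAlongAt.comps {f : M → N} {V : ∀ p, TangentSpace (𝓡 m) (f p)} {p : M}
    (hV : SmoothAlongAt (k := k) f V p) :
    ContMDiffAt (𝓡 k) 𝓘(ℝ, EuclideanSpace ℝ (Fin m)) ∞ (comps f V (f p)) p :=
  (contMDiffAt_iff_comps.1 hV).2

theorem SmoothAlongAt.mdifferentiableAt_comps {f : M → N} {V : ∀ p, TangentSpace (𝓡 m) (f p)}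
    {p : M} (hV : SmoothAlongAt (k := k) f V p) :
    MDifferentiableAt (𝓡 k) 𝓘(ℝ, EuclideanSpace ℝ (Fin m)) (LorentzianMetric.comps f V (f p)) p :=
  hV.comps.mdifferentiableAt (by simp)

theorem comps_eq_continuousLinearMapAt (f : M → N) (V : ∀ p, TangentSpace (𝓡 m) (f p)) (y : N)
    {q : M} (hq : f q ∈ (chartAt (EuclideanSpace ℝ (Fin m)) y).source) :
    comps f V y q = (trivializationAt (EuclideanSpace ℝ (Fin m))
      (TangentSpace (𝓡 m) : N → Type _) y).continuousLinearMapAt ℝ (f q) (V q) := by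
  rw [Bundle.Trivialization.continuousLinearMapAt_apply,
    Bundle.Trivialization.coe_linearMapAt_of_mem _ hq]
  rfl

theorem symmL_comps (f : M → N) (V : ∀ p, TangentSpace (𝓡 m) (f p)) (y : N) {q : M}
    (hq : f q ∈ (chartAt (EuclideanSpace ℝ (Fin m)) y).source) :
    (trivializationAt (EuclideanSpace ℝ (Fin m))
      (TangentSpace (𝓡 m) : N → Type _) y).symmL ℝ (f q) (comps f V y q) = V q := by
  rw [comps_eq_continuousLinearMapAt f V y hq]
  exact Bundle.Trivialization.symmL_continuousLinearMapAt _ hq _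

theorem eventually_mem_source {f : M → N} {p : M} (hf : ContinuousAt f p) :
    ∀ᶠ q in nhds p, f q ∈ (chartAt (EuclideanSpace ℝ (Fin m)) (f p)).source :=
  hf.eventually ((chartAt _ (f p)).open_source.mem_nhds (mem_chart_source _ _))

theorem SmoothAlongAt.eventually {f : M → N} {V : ∀ p, TangentSpace (𝓡 m) (f p)} {p : M}
    (hV : SmoothAlongAt (k := k) f V p) :
    ∀ᶠ q in nhds p, f q ∈ (chartAt (EuclideanSpace ℝ (Fin m)) (f p)).source :=
  eventually_mem_source hV.base.continuousAt

theorem chartMetric_comps (g : LorentzianMetric m N) (f : M → N)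
    (V W : ∀ p, TangentSpace (𝓡 m) (f p)) (y : N) {q : M}
    (hq : f q ∈ (chartAt (EuclideanSpace ℝ (Fin m)) y).source) :
    g.chartMetric y (f q) (comps f V y q) (comps f W y q) = g.inner (f q) (V q) (W q) := by
  rw [chartMetric_apply]
  simp only [symmL_comps f _ y hq]

theorem chartMetric_self (g : LorentzianMetric m N) (y : N) :
    g.chartMetric y y = g.inner y := by
  refine ContinuousLinearMap.ext fun v ↦ ContinuousLinearMap.ext fun w ↦ ?_
  rw [chartMetric_apply]
  simp only [symmL_self]
  rfl

theorem chartMetric_symm (g : LorentzianMetric m N) (y x : N) (v w : EuclideanSpace ℝ (Fin m)) :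
    g.chartMetric y x v w = g.chartMetric y x w v := by
  simp only [chartMetric_apply]
  exact g.symm _ _ _

/-- On the chart domain, trivializing the bundle of bilinear forms amounts to inserting the inverse
trivialization of the tangent bundle in both slots. -/
theorem contMDiffAt_chartMetric (g : LorentzianMetric m N) (y : N) :
    ContMDiffAt (𝓡 m) 𝓘(ℝ, EuclideanSpace ℝ (Fin m) →L[ℝ] EuclideanSpace ℝ (Fin m) →L[ℝ] ℝ) ∞
      (g.chartMetric y) y := by
  have h := (Bundle.contMDiffAt_section y).1 (g.contMDiff y)
  refine h.congr_of_eventuallyEq ?_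
  filter_upwards [(chartAt (EuclideanSpace ℝ (Fin m)) y).open_source.mem_nhds
    (mem_chart_source _ _)] with x hx
  refine ContinuousLinearMap.ext fun v ↦ ContinuousLinearMap.ext fun w ↦ ?_
  rw [chartMetric_apply]
  simp [hom_trivializationAt_apply, ContinuousLinearMap.inCoordinates,
    Bundle.Trivialization.coe_linearMapAt_of_mem, hx]

theorem contMDiffAt_inner (g : LorentzianMetric m N) {f : M → N}
    {V W : ∀ p, TangentSpace (𝓡 m) (f p)} {p : M}
    (hV : SmoothAlongAt (k := k) f V p) (hW : SmoothAlongAt (k := k) f W p) :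
    ContMDiffAt (𝓡 k) 𝓘(ℝ) ∞ (fun p ↦ g.inner (f p) (V p) (W p)) p := by
  have h := ((ContMDiffAt.comp p (g.contMDiffAt_chartMetric (f p)) hV.base).clm_apply
    hV.comps).clm_apply hW.comps
  refine h.congr_of_eventuallyEq ?_
  filter_upwards [hV.eventually] with q hq
  exact (g.chartMetric_comps f V W _ hq).symm

theorem comps_add_eventuallyEq {f : M → N} {V : ∀ p, TangentSpace (𝓡 m) (f p)} {p : M}
    (hV : SmoothAlongAt (k := k) f V p) (W : ∀ p, TangentSpace (𝓡 m) (f p)) :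
    comps f (fun q ↦ V q + W q) (f p) =ᶠ[nhds p] comps f V (f p) + comps f W (f p) := by
  filter_upwards [hV.eventually] with q hq
  rw [Pi.add_apply]
  simp only [comps_eq_continuousLinearMapAt f _ _ hq, map_add]

theorem comps_smul_eventuallyEq {f : M → N} {V : ∀ p, TangentSpace (𝓡 m) (f p)} {p : M}
    (hV : SmoothAlongAt (k := k) f V p) (a : M → ℝ) :
    comps f (fun q ↦ a q • V q) (f p) =ᶠ[nhds p] a • comps f V (f p) := by
  filter_upwards [hV.eventually] with q hq
  rw [Pi.smul_apply']
  simp only [comps_eq_continuousLinearMapAt f _ _ hq, map_smul]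

theorem SmoothAlongAt.add {f : M → N} {V W : ∀ p, TangentSpace (𝓡 m) (f p)} {p : M}
    (hV : SmoothAlongAt (k := k) f V p) (hW : SmoothAlongAt (k := k) f W p) :
    SmoothAlongAt (k := k) f (fun q ↦ V q + W q) p :=
  contMDiffAt_iff_comps.2 ⟨hV.base, (hV.comps.add hW.comps).congr_of_eventuallyEq
    (comps_add_eventuallyEq hV W)⟩

theorem SmoothAlongAt.smul {f : M → N} {a : M → ℝ} {V : ∀ p, TangentSpace (𝓡 m) (f p)} {p : M}
    (hV : SmoothAlongAt (k := k) f V p) (ha : ContMDiffAt (𝓡 k) 𝓘(ℝ) ∞ a p) :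
    SmoothAlongAt (k := k) f (fun q ↦ a q • V q) p :=
  contMDiffAt_iff_comps.2 ⟨hV.base, (ha.smul hV.comps).congr_of_eventuallyEq
    (comps_smul_eventuallyEq hV a)⟩

theorem SmoothAlong.contMDiff_inner (g : LorentzianMetric m N) {f : M → N}
    {V W : ∀ p, TangentSpace (𝓡 m) (f p)}
    (hV : SmoothAlong (k := k) f V) (hW : SmoothAlong (k := k) f W) :
    ContMDiff (𝓡 k) 𝓘(ℝ) ∞ (fun p ↦ g.inner (f p) (V p) (W p)) :=
  fun p ↦ g.contMDiffAt_inner (hV p) (hW p)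

theorem SmoothAlong.add {f : M → N} {V W : ∀ p, TangentSpace (𝓡 m) (f p)}
    (hV : SmoothAlong (k := k) f V) (hW : SmoothAlong (k := k) f W) :
    SmoothAlong (k := k) f (fun q ↦ V q + W q) := fun p ↦ (hV p).add (hW p)

theorem SmoothAlong.smul {f : M → N} {a : M → ℝ} {V : ∀ p, TangentSpace (𝓡 m) (f p)}
    (hV : SmoothAlong (k := k) f V) (ha : ContMDiff (𝓡 k) 𝓘(ℝ) ∞ a) :
    SmoothAlong (k := k) f (fun q ↦ a q • V q) := fun p ↦ (hV p).smul (ha p)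

/-- The derivative of the components of a vector field along `f`. -/
noncomputable def dComps (f : M → N) (V : ∀ p, TangentSpace (𝓡 m) (f p)) (p : M)
    (X : TangentSpace (𝓡 k) p) :
    TangentSpace (𝓡 m) (f p) :=
  mvfderiv (𝓡 k) (comps f V (f p)) p X

theorem covAlong_eq (g : LorentzianMetric m N) (f : M → N)
    (V : ∀ p, TangentSpace (𝓡 m) (f p)) (p : M) (X : TangentSpace (𝓡 k) p) :
    g.covAlong f V p X = dComps f V p X
      + g.christoffel (f p) (mfderiv (𝓡 k) (𝓡 m) f p X) (V p) := rfl

theorem ext_inner (g : LorentzianMetric m N) {y : N} {v v' : TangentSpace (𝓡 m) y}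
    (h : ∀ w, g.inner y v w = g.inner y v' w) : v = v' := by
  refine sub_eq_zero.1 ((g.form_nondegenerate y).1 _ fun w ↦ ?_)
  change g.inner y (v - v') w = 0
  rw [map_sub, sub_apply, h, sub_self]

theorem christoffel_add (g : LorentzianMetric m N) (y : N) (u v w : TangentSpace (𝓡 m) y) :
    g.christoffel y u (v + w) = g.christoffel y u v + g.christoffel y u w := by
  have key {E : Type} [NormedAddCommGroup E] [NormedSpace ℝ E] (T : E →L[ℝ] E →L[ℝ] E →L[ℝ] ℝ)
      (u v w t : E) : 1 / 2 * (T u (v + w) t + T (v + w) u t - T t u (v + w)) =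
        1 / 2 * (T u v t + T v u t - T t u v) + 1 / 2 * (T u w t + T w u t - T t u w) := by
    simp only [map_add, add_apply]
    ring
  refine g.ext_inner fun t ↦ ?_
  rw [map_add, add_apply, inner_christoffel, inner_christoffel, inner_christoffel]
  exact key (g.dChartMetric y) u v w t

theorem christoffel_smul (g : LorentzianMetric m N) (y : N) (c : ℝ) (u v : TangentSpace (𝓡 m) y) :
    g.christoffel y u (c • v) = c • g.christoffel y u v := by
  have key {E : Type} [NormedAddCommGroup E] [NormedSpace ℝ E] (T : E →L[ℝ] E →L[ℝ] E →L[ℝ] ℝ)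
      (u v t : E) : 1 / 2 * (T u (c • v) t + T (c • v) u t - T t u (c • v)) =
        c • (1 / 2 * (T u v t + T v u t - T t u v)) := by
    simp only [map_smul, smul_apply, smul_eq_mul]
    ring
  refine g.ext_inner fun t ↦ ?_
  rw [map_smul, smul_apply, inner_christoffel, inner_christoffel]
  exact key (g.dChartMetric y) u v t

theorem mvfderiv_congr {E : Type*} [NormedAddCommGroup E] [NormedSpace ℝ E] {a b : M → E} {p : M}
    (h : a =ᶠ[nhds p] b) : mvfderiv (𝓡 k) a p = mvfderiv (𝓡 k) b p := by
  change (mfderiv (𝓡 k) 𝓘(ℝ, E) a p : EuclideanSpace ℝ (Fin k) →L[ℝ] E) =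
    mfderiv (𝓡 k) 𝓘(ℝ, E) b p
  exact h.mfderiv_eq

theorem covAlong_add (g : LorentzianMetric m N) {f : M → N} {V W : ∀ p, TangentSpace (𝓡 m) (f p)}
    (hV : SmoothAlong (k := k) f V) (hW : SmoothAlong (k := k) f W)
    (p : M) (X : TangentSpace (𝓡 k) p) :
    g.covAlong f (fun q ↦ V q + W q) p X = g.covAlong f V p X + g.covAlong f W p X := by
  have h : dComps f (fun q ↦ V q + W q) p X = dComps f V p X + dComps f W p X := by
    unfold dComps
    rw [mvfderiv_congr (comps_add_eventuallyEq (hV p) W),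
      mvfderiv_add (hV p).mdifferentiableAt_comps (hW p).mdifferentiableAt_comps]
    rfl
  rw [covAlong_eq, covAlong_eq, covAlong_eq, h, christoffel_add]
  abel

theorem covAlong_smul (g : LorentzianMetric m N) {f : M → N} {a : M → ℝ}
    {V : ∀ p, TangentSpace (𝓡 m) (f p)} (ha : ContMDiff (𝓡 k) 𝓘(ℝ) ∞ a)
    (hV : SmoothAlong (k := k) f V) (p : M) (X : TangentSpace (𝓡 k) p) :
    g.covAlong f (fun q ↦ a q • V q) p X =
      a p • g.covAlong f V p X + (mvfderiv (𝓡 k) a p X : ℝ) • V p := by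
  have h : dComps f (fun q ↦ a q • V q) p X =
      a p • dComps f V p X + (mvfderiv (𝓡 k) a p X : ℝ) • V p := by
    unfold dComps
    rw [mvfderiv_congr (comps_smul_eventuallyEq (hV p) a),
      mvfderiv_smul ((ha p).mdifferentiableAt (by simp)) (hV p).mdifferentiableAt_comps,
      comps_self]
    rfl
  rw [covAlong_eq, covAlong_eq, h, christoffel_smul, smul_add]
  abel

theorem mvfderiv_comp_vec {E : Type*} [NormedAddCommGroup E] [NormedSpace ℝ E] {f : M → N}
    {a : N → E} {p : M} (ha : MDifferentiableAt (𝓡 m) 𝓘(ℝ, E) a (f p))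
    (hf : MDifferentiableAt (𝓡 k) (𝓡 m) f p) (X : TangentSpace (𝓡 k) p) :
    mvfderiv (𝓡 k) (fun q ↦ a (f q)) p X =
      mvfderiv (𝓡 m) a (f p) (mfderiv (𝓡 k) (𝓡 m) f p X) :=
  mfderiv_comp_apply p ha hf X

/-- The chain rule for the components; it transfers `∇̄Z = φ·` from the ambient manifold to `M`. -/
theorem covAlong_comp (g : LorentzianMetric m N) {f : M → N} (hf : ContMDiff (𝓡 k) (𝓡 m) ∞ f)
    {Z : ∀ x : N, TangentSpace (𝓡 m) x}
    (hZ : ContMDiff (𝓡 m) (𝓡 m).tangent ∞ (fun x ↦ (⟨x, Z x⟩ : TangentBundle (𝓡 m) N)))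
    (p : M) (X : TangentSpace (𝓡 k) p) :
    g.covAlong f (fun q ↦ Z (f q)) p X = g.cov Z (f p) (mfderiv (𝓡 k) (𝓡 m) f p X) := by
  have hZ' : SmoothAlong (k := m) (id : N → N) Z := hZ
  have h : dComps f (fun q ↦ Z (f q)) p X =
      dComps (id : N → N) Z (f p) (mfderiv (𝓡 k) (𝓡 m) f p X) := by
    unfold dComps
    exact mvfderiv_comp_vec (hZ' (f p)).mdifferentiableAt_comps
      ((hf p).mdifferentiableAt (by simp)) X
  unfold cov
  rw [covAlong_eq, covAlong_eq, h, mfderiv_id]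
  rfl

theorem mvfderiv_clm_apply {E F : Type*} [NormedAddCommGroup E] [NormedSpace ℝ E]
    [NormedAddCommGroup F] [NormedSpace ℝ F] {a : M → E →L[ℝ] F} {b : M → E} {p : M}
    (ha : MDifferentiableAt (𝓡 k) 𝓘(ℝ, E →L[ℝ] F) a p) (hb : MDifferentiableAt (𝓡 k) 𝓘(ℝ, E) b p)
    (X : TangentSpace (𝓡 k) p) :
    mvfderiv (𝓡 k) (fun q ↦ a q (b q)) p X =
      mvfderiv (𝓡 k) a p X (b p) + a p (mvfderiv (𝓡 k) b p X) := by
  let a' : EuclideanSpace ℝ (Fin k) →L[ℝ] E →L[ℝ] F := mvfderiv (𝓡 k) a p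
  let b' : EuclideanSpace ℝ (Fin k) →L[ℝ] E := mvfderiv (𝓡 k) b p
  have h : HasMFDerivAt (𝓡 k) 𝓘(ℝ, F) (fun q ↦ a q (b q)) p
      ((a p).comp b' + a'.flip (b p)) := by
    have hb' := hb.hasMFDerivAt.2
    have ha' := ha.hasMFDerivAt.2
    refine ⟨(ha.clm_apply hb).continuousAt, ?_⟩
    have := ha'.clm_apply hb'
    simp only [writtenInExtChartAt, mfld_simps, Function.comp_def] at this ⊢
    exact this
  change (mfderiv (𝓡 k) 𝓘(ℝ, F) (fun q ↦ a q (b q)) p X : F) = _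
  rw [h.mfderiv]
  exact add_comm _ _

theorem dChartMetric_symm (g : LorentzianMetric m N) (y : N) (u : TangentSpace (𝓡 m) y)
    (v w : EuclideanSpace ℝ (Fin m)) :
    g.dChartMetric y u v w = g.dChartMetric y u w v := by
  have hg := (g.contMDiffAt_chartMetric y).mdifferentiableAt (by simp)
  have key (v w : EuclideanSpace ℝ (Fin m)) :
      mvfderiv (𝓡 m) (fun x ↦ g.chartMetric y x v w) y u = g.dChartMetric y u v w := by
    rw [mvfderiv_clm_apply (hg.clm_apply mdifferentiableAt_const) mdifferentiableAt_const,
      mvfderiv_clm_apply hg mdifferentiableAt_const, mvfderiv_const, mvfderiv_const]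
    erw [zero_apply]
    rw [map_zero, map_zero, add_zero, add_zero]
    rfl
  rw [← key, ← key]
  simp only [g.chartMetric_symm y _ v w]

/-- Infinitesimal metric compatibility: in the sum of the two Koszul formulas all terms cancel
except the two equal ones that differentiate along `u`. -/
theorem inner_christoffel_add (g : LorentzianMetric m N) (y : N) (u v w : TangentSpace (𝓡 m) y) :
    g.inner y (g.christoffel y u v) w + g.inner y v (g.christoffel y u w) =
      g.dChartMetric y u v w := by
  have h1 : g.dChartMetric y w u v = g.dChartMetric y w v u := g.dChartMetric_symm y w u v
  have h2 : g.dChartMetric y u w v = g.dChartMetric y u v w := g.dChartMetric_symm y u w v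
  have h3 : g.dChartMetric y v w u = g.dChartMetric y v u w := g.dChartMetric_symm y v w u
  rw [g.symm y v, inner_christoffel, inner_christoffel]
  linarith

/-- In the chart at `f p` the product rule produces three terms; the derivative of the metric
coefficients splits into the two Christoffel terms that complete `dV` and `dW` to covariant
derivatives. -/
theorem mvfderiv_inner (g : LorentzianMetric m N) {f : M → N}
    {V W : ∀ p, TangentSpace (𝓡 m) (f p)}
    (hV : SmoothAlong (k := k) f V) (hW : SmoothAlong (k := k) f W)
    (p : M) (X : TangentSpace (𝓡 k) p) :
    mvfderiv (𝓡 k) (fun q ↦ g.inner (f q) (V q) (W q)) p X =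
      g.inner (f p) (g.covAlong f V p X) (W p) + g.inner (f p) (V p) (g.covAlong f W p X) := by
  have hg := (g.contMDiffAt_chartMetric (f p)).mdifferentiableAt (by simp)
  have hf := (hV p).base.mdifferentiableAt (by simp)
  have hgf : MDifferentiableAt (𝓡 k)
      𝓘(ℝ, EuclideanSpace ℝ (Fin m) →L[ℝ] EuclideanSpace ℝ (Fin m) →L[ℝ] ℝ)
      (fun q ↦ g.chartMetric (f p) (f q)) p := hg.comp p hf
  have h1 : mvfderiv (𝓡 k) (fun q ↦ g.inner (f q) (V q) (W q)) p X =
      g.dChartMetric (f p) (mfderiv (𝓡 k) (𝓡 m) f p X) (V p) (W p)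
        + g.inner (f p) (dComps f V p X) (W p) + g.inner (f p) (V p) (dComps f W p X) := by
    have he : (fun q ↦ g.inner (f q) (V q) (W q)) =ᶠ[nhds p] fun q ↦
        g.chartMetric (f p) (f q) (comps f V (f p) q) (comps f W (f p) q) := by
      filter_upwards [(hV p).eventually] with q hq
      exact (g.chartMetric_comps f V W _ hq).symm
    rw [mvfderiv_congr he, mvfderiv_clm_apply (hgf.clm_apply (hV p).mdifferentiableAt_comps)
      (hW p).mdifferentiableAt_comps, mvfderiv_clm_apply hgf (hV p).mdifferentiableAt_comps,
      mvfderiv_comp_vec hg hf, chartMetric_self, comps_self, comps_self]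
    rfl
  rw [h1, covAlong_eq, covAlong_eq, map_add, map_add, add_apply, ← inner_christoffel_add]
  ring

end Calculus

/-! ### Linear algebra of degenerate hypersurfaces and smoothness of radical sections -/

section Hypersurface

variable {m k : ℕ} {N : Type*} [TopologicalSpace N]
  [ChartedSpace (EuclideanSpace ℝ (Fin m)) N] [IsManifold (𝓡 m) ∞ N]
  {M : Type*} [TopologicalSpace M] [ChartedSpace (EuclideanSpace ℝ (Fin k)) M]
  {g : LorentzianMetric m N} {f : M → N}

theorem mem_rad_iff {p : M} {X : TangentSpace (𝓡 k) p} :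
    X ∈ g.rad f p ↔ ∀ Y : TangentSpace (𝓡 k) p,
      g.inner (f p) (mfderiv (𝓡 k) (𝓡 m) f p Y) (mfderiv (𝓡 k) (𝓡 m) f p X) = 0 := by
  simp only [rad, Submodule.mem_comap, LinearMap.BilinForm.mem_orthogonal_iff]
  constructor
  · exact fun h Y ↦ h _ ⟨Y, rfl⟩
  · rintro h _ ⟨Y, rfl⟩
    exact h Y

/-- Tangent vectors are already orthogonal to the radical, so only the condition against `Z`
remains. -/
theorem mem_screenOf_iff {Z : ∀ x : N, TangentSpace (𝓡 m) x} {p : M} {X : TangentSpace (𝓡 k) p} :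
    X ∈ g.screenOf f Z p ↔ g.inner (f p) (Z (f p)) (mfderiv (𝓡 k) (𝓡 m) f p X) = 0 := by
  simp only [screenOf, Submodule.mem_comap, LinearMap.BilinForm.mem_orthogonal_iff]
  constructor
  · exact fun h ↦ h _ (Submodule.mem_sup_left (Submodule.mem_span_singleton_self _))
  · intro h W hW
    obtain ⟨A, hA, B, hB, rfl⟩ := Submodule.mem_sup.1 hW
    obtain ⟨c, rfl⟩ := Submodule.mem_span_singleton.1 hA
    obtain ⟨η, hη, rfl⟩ := hB
    change g.inner (f p) (c • Z (f p) + mfderiv (𝓡 k) (𝓡 m) f p η)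
      (mfderiv (𝓡 k) (𝓡 m) f p X) = 0
    rw [map_add, add_apply, map_smul, smul_apply, h, smul_zero, zero_add, g.symm]
    exact mem_rad_iff.1 hη X

theorem IsDegenerateHypersurface.exists_add_smul
    (hf : g.IsDegenerateHypersurface (k := k) f) {p : M} {z : TangentSpace (𝓡 m) (f p)}
    (hz : z ∉ Set.range (mfderiv (𝓡 k) (𝓡 m) f p)) (W : TangentSpace (𝓡 m) (f p)) :
    ∃ (Y : TangentSpace (𝓡 k) p) (c : ℝ), W = mfderiv (𝓡 k) (𝓡 m) f p Y + c • z := by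
  let T : TangentSpace (𝓡 k) p × ℝ →ₗ[ℝ] TangentSpace (𝓡 m) (f p) :=
    (mfderiv (𝓡 k) (𝓡 m) f p).toLinearMap.coprod (LinearMap.toSpanSingleton ℝ _ z)
  have hT (v : TangentSpace (𝓡 k) p × ℝ) :
    T v = mfderiv (𝓡 k) (𝓡 m) f p v.1 + v.2 • z := rfl
  have hinj : Function.Injective T := by
    refine (injective_iff_map_eq_zero T).2 fun v hv ↦ ?_
    rw [hT] at hv
    have hc : v.2 = 0 := by
      by_contra hc
      refine hz ⟨-(v.2⁻¹ • v.1), ?_⟩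
      rw [map_neg, map_smul, eq_neg_of_add_eq_zero_left hv, smul_neg, neg_neg, smul_smul,
        inv_mul_cancel₀ hc, one_smul]
    rw [hc, zero_smul, add_zero] at hv
    exact Prod.ext (hf.injective p (hv.trans (map_zero _).symm)) hc
  have hdim : Module.finrank ℝ (TangentSpace (𝓡 k) p × ℝ) =
      Module.finrank ℝ (TangentSpace (𝓡 m) (f p)) := by
    rw [Module.finrank_prod, Module.finrank_self]
    change Module.finrank ℝ (EuclideanSpace ℝ (Fin k)) + 1 =
      Module.finrank ℝ (EuclideanSpace ℝ (Fin m))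
    rw [finrank_euclideanSpace_fin, finrank_euclideanSpace_fin, hf.codim]
  obtain ⟨v, hv⟩ := (LinearMap.injective_iff_surjective_of_finrank_eq_finrank hdim).1 hinj W
  exact ⟨v.1, v.2, hv.symm⟩

/-- Otherwise `η` would be orthogonal to `T_pM` and to `z`, hence to the whole ambient tangent
space, against nondegeneracy. -/
theorem IsDegenerateHypersurface.inner_rad_ne_zero
    (hf : g.IsDegenerateHypersurface (k := k) f) {p : M} {z : TangentSpace (𝓡 m) (f p)}
    (hz : z ∉ Set.range (mfderiv (𝓡 k) (𝓡 m) f p)) {η : TangentSpace (𝓡 k) p}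
    (hη : η ∈ g.rad f p) (h0 : η ≠ 0) :
    g.inner (f p) (mfderiv (𝓡 k) (𝓡 m) f p η) z ≠ 0 := by
  intro h
  refine h0 (hf.injective p ?_)
  rw [map_zero]
  refine g.ext_inner fun W ↦ ?_
  obtain ⟨Y, c, rfl⟩ := hf.exists_add_smul hz W
  rw [map_add, map_smul, h, g.symm, mem_rad_iff.1 hη Y, map_zero, zero_apply, smul_zero, add_zero]

theorem IsDegenerateHypersurface.exists_rad_inner_eq
    (hf : g.IsDegenerateHypersurface (k := k) f) {p : M} {z : TangentSpace (𝓡 m) (f p)}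
    (hz : z ∉ Set.range (mfderiv (𝓡 k) (𝓡 m) f p)) (c : ℝ) :
    ∃ η ∈ g.rad (k := k) f p, g.inner (f p) (mfderiv (𝓡 k) (𝓡 m) f p η) z = c := by
  obtain ⟨η, hη, h0⟩ := Submodule.exists_mem_ne_zero_of_ne_bot (hf.degenerate p)
  have h := hf.inner_rad_ne_zero hz hη h0
  refine ⟨(c / g.inner (f p) (mfderiv (𝓡 k) (𝓡 m) f p η) z) • η, Submodule.smul_mem _ _ hη, ?_⟩
  rw [map_smul, map_smul, smul_apply, smul_eq_mul, div_mul_cancel₀ _ h]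

/-- Pairing with `z` embeds the radical in `ℝ`, so the radical is a line. -/
theorem IsDegenerateHypersurface.exists_eq_smul
    (hf : g.IsDegenerateHypersurface (k := k) f) {p : M} {z : TangentSpace (𝓡 m) (f p)}
    (hz : z ∉ Set.range (mfderiv (𝓡 k) (𝓡 m) f p)) {η ζ : TangentSpace (𝓡 k) p}
    (hη : η ∈ g.rad f p) (h0 : η ≠ 0) (hζ : ζ ∈ g.rad f p) : ∃ c : ℝ, ζ = c • η := by
  have h := hf.inner_rad_ne_zero hz hη h0
  refine ⟨g.inner (f p) (mfderiv (𝓡 k) (𝓡 m) f p ζ) z /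
    g.inner (f p) (mfderiv (𝓡 k) (𝓡 m) f p η) z, ?_⟩
  by_contra hne
  refine hf.inner_rad_ne_zero hz (Submodule.sub_mem _ hζ (Submodule.smul_mem _ _ hη))
    (sub_ne_zero.2 hne) ?_
  rw [map_sub, map_smul, map_sub, map_smul, sub_apply, smul_apply, smul_eq_mul,
    div_mul_cancel₀ _ h, sub_self]

/-- Pairing `W = Y + cz` with `η` leaves only `c ḡ(η,z)`, which forces `c = 0`. This is the tangency
criterion used below. -/
theorem IsDegenerateHypersurface.mem_range_of_inner_rad_eq_zero
    (hf : g.IsDegenerateHypersurface (k := k) f) {p : M} {z : TangentSpace (𝓡 m) (f p)}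
    (hz : z ∉ Set.range (mfderiv (𝓡 k) (𝓡 m) f p)) {η : TangentSpace (𝓡 k) p}
    (hη : η ∈ g.rad f p) (h0 : η ≠ 0) {W : TangentSpace (𝓡 m) (f p)}
    (hW : g.inner (f p) (mfderiv (𝓡 k) (𝓡 m) f p η) W = 0) :
    ∃ Y, W = mfderiv (𝓡 k) (𝓡 m) f p Y := by
  obtain ⟨Y, c, rfl⟩ := hf.exists_add_smul hz W
  rw [map_add, map_smul, g.symm, mem_rad_iff.1 hη Y, zero_add, smul_eq_mul] at hW
  rw [(mul_eq_zero.1 hW).resolve_right (hf.inner_rad_ne_zero hz hη h0), zero_smul, add_zero]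
  exact ⟨Y, rfl⟩

/-- Near `p` the solution is `u = B⁻¹ l`, and inversion of operators is smooth at an invertible one.
In finite dimension injectivity of `B p` suffices for invertibility. -/
theorem contMDiffAt_of_clm_apply_eq {F : Type*} [NormedAddCommGroup F] [NormedSpace ℝ F]
    [FiniteDimensional ℝ F] {B : M → F →L[ℝ] F →L[ℝ] ℝ} {l : M → F →L[ℝ] ℝ} {u : M → F} {p : M}
    (hB : ContMDiffAt (𝓡 k) 𝓘(ℝ, F →L[ℝ] F →L[ℝ] ℝ) ∞ B p)
    (hl : ContMDiffAt (𝓡 k) 𝓘(ℝ, F →L[ℝ] ℝ) ∞ l p)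
    (hinj : Function.Injective (B p)) (hu : ∀ᶠ q in nhds p, B q (u q) = l q) :
    ContMDiffAt (𝓡 k) 𝓘(ℝ, F) ∞ u p := by
  have : CompleteSpace F := FiniteDimensional.complete ℝ F
  have hdim : Module.finrank ℝ F = Module.finrank ℝ (F →L[ℝ] ℝ) := by
    rw [← (LinearMap.toContinuousLinearMap (𝕜 := ℝ) (E := F) (F' := ℝ)).finrank_eq]
    exact (Subspace.dual_finrank_eq).symm
  let e : F ≃L[ℝ] (F →L[ℝ] ℝ) :=
    (LinearEquiv.ofInjectiveOfFinrankEq (B p).toLinearMap hinj hdim).toContinuousLinearEquiv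
  have he : (e : F →L[ℝ] F →L[ℝ] ℝ) = B p := by
    ext v w
    rfl
  have hinv : ContMDiffAt (𝓡 k) 𝓘(ℝ, (F →L[ℝ] ℝ) →L[ℝ] F) ∞
      (fun q ↦ ContinuousLinearMap.inverse (B q)) p := by
    refine ContDiffAt.comp_contMDiffAt (g := ContinuousLinearMap.inverse) ?_ hB
    rw [← he]
    exact contDiffAt_map_inverse e
  refine (hinv.clm_apply hl).congr_of_eventuallyEq ?_
  -- Invertible operators form an open set, so near `p` the inverse is genuine and not the default
  -- value.
  have hev : ∀ᶠ q in nhds p, B q ∈ Set.range ((↑) : (F ≃L[ℝ] (F →L[ℝ] ℝ)) → _) :=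
    hB.continuousAt.eventually (by rw [← he]; exact ContinuousLinearEquiv.nhds e)
  filter_upwards [hev, hu] with q hq hq'
  obtain ⟨e', he'⟩ := hq
  rw [← hq', ← he', ContinuousLinearMap.inverse_equiv]
  exact (e'.symm_apply_apply _).symm

/-- The previous lemma applied to the pullback of the bilinear form `G` by `A`. -/
theorem contMDiffAt_of_bilin_apply_eq {E F : Type*} [NormedAddCommGroup E] [NormedSpace ℝ E]
    [NormedAddCommGroup F] [NormedSpace ℝ F] [FiniteDimensional ℝ F] {G : M → E →L[ℝ] E →L[ℝ] ℝ}
    {A : M → F →L[ℝ] E} {l : F →L[ℝ] ℝ} {c : M → ℝ} {u : M → F} {p : M}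
    (hG : ContMDiffAt (𝓡 k) 𝓘(ℝ, E →L[ℝ] E →L[ℝ] ℝ) ∞ G p)
    (hA : ContMDiffAt (𝓡 k) 𝓘(ℝ, F →L[ℝ] E) ∞ A p) (hc : ContMDiffAt (𝓡 k) 𝓘(ℝ) ∞ c p)
    (hinj : ∀ v, (∀ w, G p (A p v) (A p w) = 0) → v = 0)
    (hu : ∀ᶠ q in nhds p, ∀ w, G q (A q (u q)) (A q w) = c q * l w) :
    ContMDiffAt (𝓡 k) 𝓘(ℝ, F) ∞ u p := by
  have hB : ContMDiffAt (𝓡 k) 𝓘(ℝ, F →L[ℝ] F →L[ℝ] ℝ) ∞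
      (fun q ↦ ((A q).precomp ℝ).comp ((G q).comp (A q))) p := by
    have h1 : ContMDiffAt (𝓡 k) 𝓘(ℝ, F →L[ℝ] E →L[ℝ] ℝ) ∞ (fun q ↦ (G q).comp (A q)) p :=
      ContMDiffAt.clm_comp (F₁ := E) (F₂ := F) (F₃ := E →L[ℝ] ℝ) hG hA
    have h2 : ContMDiffAt (𝓡 k) 𝓘(ℝ, (E →L[ℝ] ℝ) →L[ℝ] F →L[ℝ] ℝ) ∞ (fun q ↦ (A q).precomp ℝ) p :=
      ContMDiffAt.clm_precomp (F₁ := F) (F₂ := E) (F₃ := ℝ) hA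
    exact ContMDiffAt.clm_comp (F₁ := E →L[ℝ] ℝ) (F₂ := F) (F₃ := F →L[ℝ] ℝ) h2 h1
  have hl : ContMDiffAt (𝓡 k) 𝓘(ℝ, F →L[ℝ] ℝ) ∞ (fun q ↦ c q • l) p := hc.smul contMDiffAt_const
  refine contMDiffAt_of_clm_apply_eq hB hl ?_ ?_
  · refine (injective_iff_map_eq_zero _).2 fun v hv ↦ hinj v fun w ↦ ?_
    exact DFunLike.congr_fun hv w
  · filter_upwards [hu] with q hq
    exact ContinuousLinearMap.ext hq

theorem contMDiffAt_coprod_smulRight {E F : Type*} [NormedAddCommGroup E] [NormedSpace ℝ E]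
    [NormedAddCommGroup F] [NormedSpace ℝ F] {D : M → F →L[ℝ] E} {v : M → E} {p : M}
    (hD : ContMDiffAt (𝓡 k) 𝓘(ℝ, F →L[ℝ] E) ∞ D p) (hv : ContMDiffAt (𝓡 k) 𝓘(ℝ, E) ∞ v p) :
    ContMDiffAt (𝓡 k) 𝓘(ℝ, F × ℝ →L[ℝ] E) ∞ (fun q ↦ (D q).comp (ContinuousLinearMap.fst ℝ F ℝ) +
      (ContinuousLinearMap.snd ℝ F ℝ).smulRight (v q)) p := by
  refine (hD.clm_comp contMDiffAt_const).add ?_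
  exact (ContinuousLinearMap.smulRightL ℝ (F × ℝ) E
    (ContinuousLinearMap.snd ℝ F ℝ)).contMDiff.contMDiffAt.comp p hv

variable [IsManifold (𝓡 k) ∞ M]

theorem smoothAlongAt_mfderiv (hf : ContMDiff (𝓡 k) (𝓡 m) ∞ f)
    {Y : ∀ p : M, TangentSpace (𝓡 k) p} {p : M} (hY : SmoothAlongAt (k := k) (id : M → M) Y p) :
    SmoothAlongAt (k := k) f (fun q ↦ mfderiv (𝓡 k) (𝓡 m) f q (Y q)) p :=
  ContMDiffAt.comp p ((hf.contMDiff_tangentMap (by simp)) _) hY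

theorem smoothAlong_mfderiv (hf : ContMDiff (𝓡 k) (𝓡 m) ∞ f) {Y : ∀ p : M, TangentSpace (𝓡 k) p}
    (hY : ContMDiff (𝓡 k) (𝓡 k).tangent ∞ (fun p ↦ (⟨p, Y p⟩ : TangentBundle (𝓡 k) M))) :
    SmoothAlong (k := k) f (fun q ↦ mfderiv (𝓡 k) (𝓡 m) f q (Y q)) :=
  fun p ↦ smoothAlongAt_mfderiv hf (hY p)

/-- A section of the radical is smooth as soon as its product with a smooth transversal field is. -/
theorem IsDegenerateHypersurface.contMDiff_of_mem_rad
    (hf : g.IsDegenerateHypersurface (k := k) f) {V : ∀ p : M, TangentSpace (𝓡 m) (f p)}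
    (hV : SmoothAlong (k := k) f V)
    (hVt : ∀ p, V p ∉ Set.range (mfderiv (𝓡 k) (𝓡 m) f p)) {ξ : ∀ p : M, TangentSpace (𝓡 k) p}
    (hξ : ∀ p, ξ p ∈ g.rad f p) (hs : ContMDiff (𝓡 k) 𝓘(ℝ) ∞
      fun p ↦ g.inner (f p) (mfderiv (𝓡 k) (𝓡 m) f p (ξ p)) (V p)) :
    ContMDiff (𝓡 k) (𝓡 k).tangent ∞ (fun p ↦ (⟨p, ξ p⟩ : TangentBundle (𝓡 k) M)) := by
  intro p
  refine contMDiffAt_iff_comps.2 ⟨contMDiffAt_id, ?_⟩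
  let s (q : M) : EuclideanSpace ℝ (Fin k) →L[ℝ] TangentSpace (𝓡 k) q :=
    (trivializationAt (EuclideanSpace ℝ (Fin k)) (TangentSpace (𝓡 k) : M → Type _) p).symmL ℝ q
  let D (q : M) : EuclideanSpace ℝ (Fin k) →L[ℝ] EuclideanSpace ℝ (Fin m) :=
    inTangentCoordinates (𝓡 k) (𝓡 m) id f (fun q ↦ mfderiv (𝓡 k) (𝓡 m) f q) p q
  -- `A q` is the splitting `T_qM ⊕ ℝV ≅ T_{f(q)}N` in coordinates, and `T q` is the same map
  -- without them.
  let A (q : M) : EuclideanSpace ℝ (Fin k) × ℝ →L[ℝ] EuclideanSpace ℝ (Fin m) :=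
    (D q).comp (ContinuousLinearMap.fst ℝ _ _) +
      (ContinuousLinearMap.snd ℝ _ _).smulRight (comps f V (f p) q)
  let T (q : M) (v : EuclideanSpace ℝ (Fin k) × ℝ) : TangentSpace (𝓡 m) (f q) :=
    mfderiv (𝓡 k) (𝓡 m) f q (s q v.1) + v.2 • V q
  have hAT {q : M} (hq : f q ∈ (chartAt (EuclideanSpace ℝ (Fin m)) (f p)).source)
      (v : EuclideanSpace ℝ (Fin k) × ℝ) : A q v = comps f (fun q ↦ T q v) (f p) q := by
    rw [comps_eq_continuousLinearMapAt f _ _ hq, map_add, map_smul,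
      ← comps_eq_continuousLinearMapAt f _ _ hq]
    rfl
  have hGT {q : M} (hq : f q ∈ (chartAt (EuclideanSpace ℝ (Fin m)) (f p)).source)
      (v w : EuclideanSpace ℝ (Fin k) × ℝ) :
      g.chartMetric (f p) (f q) (A q v) (A q w) = g.inner (f q) (T q v) (T q w) := by
    rw [← g.chartMetric_comps f (fun q ↦ T q v) (fun q ↦ T q w) (f p) hq, ← hAT hq, ← hAT hq]
  have hD : ContMDiffAt (𝓡 k) 𝓘(ℝ, EuclideanSpace ℝ (Fin k) →L[ℝ] EuclideanSpace ℝ (Fin m)) ∞ D p :=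
    (hf.contMDiff p).mfderiv_const (by simp)
  have hA := contMDiffAt_coprod_smulRight hD (hV p).comps
  have hG := ContMDiffAt.comp p (g.contMDiffAt_chartMetric (f p)) (hf.contMDiff p)
  have hinj (v : EuclideanSpace ℝ (Fin k) × ℝ)
      (hv : ∀ w, g.chartMetric (f p) (f p) (A p v) (A p w) = 0) : v = 0 := by
    have hsp (Y : EuclideanSpace ℝ (Fin k)) : s p Y = Y := symmL_self p Y
    have h0 : T p v = 0 := by
      refine g.ext_inner fun W ↦ ?_
      obtain ⟨Y, c, rfl⟩ := hf.exists_add_smul (hVt p) W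
      have h2 : T p (Y, c) = mfderiv (𝓡 k) (𝓡 m) f p Y + c • V p := by
        change mfderiv (𝓡 k) (𝓡 m) f p (s p Y) + c • V p = _
        rw [show s p Y = Y from hsp Y]
      rw [← h2, ← hGT (mem_chart_source _ (f p)) v (Y, c), hv, map_zero]
      rfl
    have hc : v.2 = 0 := by
      by_contra hc
      refine hVt p ⟨-(v.2⁻¹ • s p v.1), ?_⟩
      rw [map_neg, map_smul, eq_neg_of_add_eq_zero_left h0, smul_neg, neg_neg, smul_smul,
        inv_mul_cancel₀ hc, one_smul]
    simp only [T, hc, zero_smul, add_zero] at h0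
    rw [show s p v.1 = v.1 from hsp v.1] at h0
    exact Prod.ext (hf.injective p (h0.trans (map_zero _).symm)) hc
  -- The linear system for `ξ`: it is orthogonal to the `TM` factor, and its product with `V` is the
  -- given smooth function.
  have hu : ∀ᶠ q in nhds p, ∀ w, g.chartMetric (f p) (f q)
      (A q (comps (id : M → M) ξ p q, 0)) (A q w) =
      g.inner (f q) (mfderiv (𝓡 k) (𝓡 m) f q (ξ q)) (V q) *
        ContinuousLinearMap.snd ℝ (EuclideanSpace ℝ (Fin k)) ℝ w := by
    filter_upwards [(hV p).eventually,
      eventually_mem_source (m := k) (f := (id : M → M)) continuousAt_id]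
      with q hq hq' w
    have h1 : s q (comps (id : M → M) ξ p q) = ξ q := symmL_comps (id : M → M) ξ p hq'
    have h2 : T q (comps (id : M → M) ξ p q, 0) = mfderiv (𝓡 k) (𝓡 m) f q (ξ q) := by
      simp only [T, h1, zero_smul, add_zero]
    rw [hGT hq, h2]
    simp only [T]
    rw [map_add, g.symm, mem_rad_iff.1 (hξ q), zero_add, map_smul]
    exact mul_comm _ _
  exact contDiff_fst.comp_contMDiffAt (contMDiffAt_of_bilin_apply_eq hG hA (hs p) hinj hu)

end Hypersurface

/-! ### Smooth frames for the kernel of a one-form -/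

section Screen

variable {m k : ℕ} {N : Type*} [TopologicalSpace N]
  [ChartedSpace (EuclideanSpace ℝ (Fin m)) N] [IsManifold (𝓡 m) ∞ N]
  {M : Type*} [TopologicalSpace M] [ChartedSpace (EuclideanSpace ℝ (Fin k)) M]
  [IsManifold (𝓡 k) ∞ M] {g : LorentzianMetric m N} {f : M → N}

theorem comps_symmL {p q : M} (hq : q ∈ (chartAt (EuclideanSpace ℝ (Fin k)) p).source)
    (v : EuclideanSpace ℝ (Fin k)) :
    comps (id : M → M) (fun q ↦ (trivializationAt (EuclideanSpace ℝ (Fin k))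
      (TangentSpace (𝓡 k) : M → Type _) p).symmL ℝ q v) p q = v := by
  rw [comps_eq_continuousLinearMapAt (id : M → M) _ p hq]
  exact Bundle.Trivialization.continuousLinearMapAt_symmL _ hq v

theorem smoothAlongAt_symmL {p q : M} (hq : q ∈ (chartAt (EuclideanSpace ℝ (Fin k)) p).source)
    (v : EuclideanSpace ℝ (Fin k)) :
    SmoothAlongAt (k := k) (id : M → M) (fun q ↦ (trivializationAt (EuclideanSpace ℝ (Fin k))
      (TangentSpace (𝓡 k) : M → Type _) p).symmL ℝ q v) q := by
  have h := (Bundle.Trivialization.contMDiffOn_section_baseSet_iff (IB := 𝓡 k) (n := ∞)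
    (s := fun q ↦ (trivializationAt (EuclideanSpace ℝ (Fin k))
      (TangentSpace (𝓡 k) : M → Type _) p).symmL ℝ q v)
    (trivializationAt (EuclideanSpace ℝ (Fin k)) (TangentSpace (𝓡 k) : M → Type _) p)).2
    ((contMDiffOn_const (c := v)).congr fun x hx ↦ comps_symmL hx v)
  exact h.contMDiffAt ((chartAt _ p).open_source.mem_nhds hq)

/-- The kernel of a smooth one-form that is nowhere zero on a smooth field `ξ` is a smooth
distribution. -/
theorem isSmoothDistribution_of_mem_iff (hf : ContMDiff (𝓡 k) (𝓡 m) ∞ f)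
    {V : ∀ p : M, TangentSpace (𝓡 m) (f p)} (hV : SmoothAlong (k := k) f V)
    {ξ : ∀ p : M, TangentSpace (𝓡 k) p} (hξ : SmoothAlong (k := k) (id : M → M) ξ)
    (h0 : ∀ p, g.inner (f p) (V p) (mfderiv (𝓡 k) (𝓡 m) f p (ξ p)) ≠ 0)
    {S : ∀ p : M, Submodule ℝ (TangentSpace (𝓡 k) p)}
    (hS : ∀ p (X : TangentSpace (𝓡 k) p),
      X ∈ S p ↔ g.inner (f p) (V p) (mfderiv (𝓡 k) (𝓡 m) f p X) = 0) :
    IsSmoothDistribution S := by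
  -- The rank is constant, so independent sections of `S` of the right number automatically span it.
  have hdim (q : M) : Module.finrank ℝ (S q) + 1 = k := by
    let l : Module.Dual ℝ (TangentSpace (𝓡 k) q) :=
      ((g.inner (f q) (V q)).comp (mfderiv (𝓡 k) (𝓡 m) f q)).toLinearMap
    have hl : S q = LinearMap.ker l := by
      ext X
      exact hS q X
    have hl0 : l ≠ 0 := fun h ↦ h0 q (LinearMap.congr_fun h (ξ q))
    rw [hl, Module.Dual.finrank_ker_add_one_of_ne_zero hl0]
    exact finrank_euclideanSpace_fin
  intro p
  let b := Module.finBasis ℝ (S p)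
  let X (i : Fin (Module.finrank ℝ (S p))) (q : M) : TangentSpace (𝓡 k) q :=
    (trivializationAt (EuclideanSpace ℝ (Fin k)) (TangentSpace (𝓡 k) : M → Type _) p).symmL ℝ q
      (b i : TangentSpace (𝓡 k) p)
  -- A basis of `S p` is extended with constant components, then corrected along `ξ` to stay in the
  -- kernel. The correction vanishes at `p`, so the fields remain independent nearby.
  let c (i : Fin (Module.finrank ℝ (S p))) (q : M) : ℝ :=
    -(g.inner (f q) (V q) (mfderiv (𝓡 k) (𝓡 m) f q (X i q)) /
      g.inner (f q) (V q) (mfderiv (𝓡 k) (𝓡 m) f q (ξ q)))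
  let s (i : Fin (Module.finrank ℝ (S p))) (q : M) : TangentSpace (𝓡 k) q :=
    X i q + c i q • ξ q
  have hsm (i) {q : M} (hq : q ∈ (chartAt (EuclideanSpace ℝ (Fin k)) p).source) :
      SmoothAlongAt (k := k) (id : M → M) (s i) q := by
    have hX : SmoothAlongAt (k := k) (id : M → M) (X i) q := smoothAlongAt_symmL hq _
    refine hX.add ((hξ q).smul (ContMDiffAt.neg (ContMDiffAt.div₀ ?_ ?_ (h0 q))))
    · exact g.contMDiffAt_inner (hV q) (smoothAlongAt_mfderiv hf hX)
    · exact g.contMDiffAt_inner (hV q) (smoothAlongAt_mfderiv hf (hξ q))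
  have hmem (i) (q : M) : s i q ∈ S q := by
    rw [hS, map_add, map_add, map_smul, map_smul, smul_eq_mul, neg_mul, div_mul_cancel₀ _ (h0 q),
      add_neg_cancel]
  have hsp (i) : s i p = b i := by
    have h1 : X i p = b i := symmL_self p _
    have h2 : c i p = 0 := by
      simp only [c, h1]
      rw [(hS p _).1 (b i).2, zero_div, neg_zero]
    simp only [s, h1, h2, zero_smul, add_zero]
  have hli : ∀ᶠ q in nhds p, LinearIndependent ℝ fun i ↦ comps (id : M → M) (s i) p q := by
    have hc : ContinuousAt (fun q i ↦ comps (id : M → M) (s i) p q) p :=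
      continuousAt_pi.2 fun i ↦ (hsm i (mem_chart_source _ p)).comps.continuousAt
    refine hc.eventually (isOpen_setOfPred_linearIndependent.mem_nhds ?_)
    have h1 (i) : comps (id : M → M) (s i) p p = (b i).1 :=
      (comps_self (id : M → M) _ p).trans (hsp i)
    simp only [h1]
    exact b.linearIndependent.map' (S p).subtype (Submodule.ker_subtype _)
  obtain ⟨U, hUli, hUo, hpU⟩ := eventually_nhds_iff.1
    (hli.and ((chartAt (EuclideanSpace ℝ (Fin k)) p).open_source.mem_nhds (mem_chart_source _ p)))
  refine ⟨U, hUo, hpU, _, s, fun i q hq ↦ ContMDiffAt.contMDiffWithinAt (hsm i (hUli q hq).2),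
    fun q hq ↦ ?_⟩
  have hliq : LinearIndependent ℝ fun i ↦ s i q := by
    have h := (hUli q hq).1
    simp only [comps_eq_continuousLinearMapAt (id : M → M) _ p (hUli q hq).2] at h
    exact LinearIndependent.of_comp (ContinuousLinearMap.toLinearMap _) h
  refine ⟨hliq, Submodule.eq_of_le_of_finrank_eq ?_ ?_⟩
  · exact Submodule.span_le.2 (Set.range_subset_iff.2 fun i ↦ hmem i q)
  · rw [finrank_span_eq_card hliq, Fintype.card_fin]
    have h1 := hdim p
    have h2 := hdim q
    omega

end Screen

/-! ### Null frames and their structure equations -/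

section NullFrame

variable {m k : ℕ} {N : Type*} [TopologicalSpace N]
  [ChartedSpace (EuclideanSpace ℝ (Fin m)) N] [IsManifold (𝓡 m) ∞ N]
  {M : Type*} [TopologicalSpace M] [ChartedSpace (EuclideanSpace ℝ (Fin k)) M]
  [IsManifold (𝓡 k) ∞ M] {g : LorentzianMetric m N} {f : M → N}
  {S : ∀ p : M, Submodule ℝ (TangentSpace (𝓡 k) p)}
  {ξ : ∀ p : M, TangentSpace (𝓡 k) p} {ν : ∀ p : M, TangentSpace (𝓡 m) (f p)}

theorem IsNullFrame.notMem_range (h : g.IsNullFrame f S ξ ν) (p : M) :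
    ν p ∉ Set.range (mfderiv (𝓡 k) (𝓡 m) f p) := by
  rintro ⟨Y, hY⟩
  have h1 := h.inner_eq_one p
  rw [← hY, g.symm, mem_rad_iff.1 (h.mem_rad p)] at h1
  exact zero_ne_one h1

/-- `tangentPart` is a choice, so its value is known only through uniqueness: two candidates differ
by a tangent vector proportional to the transversal `ν p`. -/
theorem tangentPart_add_smul {p : M} (hinj : Function.Injective (mfderiv (𝓡 k) (𝓡 m) f p))
    (hν : ν p ∉ Set.range (mfderiv (𝓡 k) (𝓡 m) f p)) (Y : TangentSpace (𝓡 k) p) (c : ℝ) :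
    tangentPart f ν p (mfderiv (𝓡 k) (𝓡 m) f p Y + c • ν p) = Y := by
  have hex : ∃ Y', mfderiv (𝓡 k) (𝓡 m) f p Y + c • ν p - mfderiv (𝓡 k) (𝓡 m) f p Y' ∈
      Submodule.span ℝ {ν p} :=
    ⟨Y, by rw [add_sub_cancel_left]; exact Submodule.mem_span_singleton.2 ⟨c, rfl⟩⟩
  obtain ⟨d, hd⟩ := Submodule.mem_span_singleton.1 (Classical.epsilon_spec hex)
  change d • ν p = mfderiv (𝓡 k) (𝓡 m) f p Y + c • ν p - mfderiv (𝓡 k) (𝓡 m) f p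
    (tangentPart (k := k) f ν p (mfderiv (𝓡 k) (𝓡 m) f p Y + c • ν p)) at hd
  generalize tangentPart (k := k) f ν p (mfderiv (𝓡 k) (𝓡 m) f p Y + c • ν p) = Y' at hd ⊢
  have h1 : (d - c) • ν p = mfderiv (𝓡 k) (𝓡 m) f p (Y - Y') := by
    rw [sub_smul, hd, map_sub]
    abel
  have h2 : d - c = 0 := by
    by_contra h2
    refine hν ⟨(d - c)⁻¹ • (Y - Y'), ?_⟩
    rw [map_smul, ← h1, smul_smul, inv_mul_cancel₀ h2, one_smul]
  rw [h2, zero_smul] at h1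
  exact (sub_eq_zero.1 (hinj (h1.symm.trans (map_zero _).symm))).symm

theorem tangentPart_mfderiv {p : M} (hinj : Function.Injective (mfderiv (𝓡 k) (𝓡 m) f p))
    (hν : ν p ∉ Set.range (mfderiv (𝓡 k) (𝓡 m) f p)) (Y : TangentSpace (𝓡 k) p) :
    tangentPart f ν p (mfderiv (𝓡 k) (𝓡 m) f p Y) = Y := by
  have h := tangentPart_add_smul hinj hν Y 0
  rwa [zero_smul, add_zero] at h

theorem screenProj_spec {p : M} (hS : IsCompl (S p) (g.rad f p)) (X : TangentSpace (𝓡 k) p) :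
    g.screenProj f S p X ∈ S p ∧ X - g.screenProj f S p X ∈ g.rad f p := by
  refine Classical.epsilon_spec (p := fun Y ↦ Y ∈ S p ∧ X - Y ∈ g.rad f p) ?_
  obtain ⟨Y, hY, R, hR, h⟩ := Submodule.mem_sup.1 (hS.sup_eq_top ▸ Submodule.mem_top (x := X))
  exact ⟨Y, hY, by rw [← h, add_sub_cancel_left]; exact hR⟩

/-- `∇̄_X ξ` is tangent to the hypersurface. -/
theorem IsNullFrame.exists_covAlong_rad (hf : g.IsDegenerateHypersurface (k := k) f)
    (h : g.IsNullFrame f S ξ ν) (p : M) (X : TangentSpace (𝓡 k) p) :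
    ∃ U, g.covAlong f (fun q ↦ mfderiv (𝓡 k) (𝓡 m) f q (ξ q)) p X =
      mfderiv (𝓡 k) (𝓡 m) f p U := by
  have hξ := smoothAlong_mfderiv hf.contMDiff h.contMDiff_rad
  refine hf.mem_range_of_inner_rad_eq_zero (h.notMem_range p) (h.mem_rad p) (h.ne_zero p) ?_
  -- Differentiating `ḡ(ξ,ξ) = 0` gives `ḡ(∇̄_X ξ,ξ) = 0`.
  have h1 := g.mvfderiv_inner hξ hξ p X
  simp only [fun q ↦ mem_rad_iff.1 (h.mem_rad q) (ξ q)] at h1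
  rw [mvfderiv_const, zero_apply, g.symm _ (g.covAlong _ _ _ _)] at h1
  linarith

/-- `∇̄_X ν` has its tangential part in the screen distribution. -/
theorem IsNullFrame.exists_covAlong_transversal (hf : g.IsDegenerateHypersurface (k := k) f)
    (hS : ∀ p, IsCompl (S p) (g.rad f p)) (h : g.IsNullFrame f S ξ ν) (p : M)
    (X : TangentSpace (𝓡 k) p) :
    ∃ V ∈ S p, ∃ c : ℝ, g.covAlong f ν p X = mfderiv (𝓡 k) (𝓡 m) f p V + c • ν p := by
  obtain ⟨V, c, hV⟩ := hf.exists_add_smul (h.notMem_range p) (g.covAlong f ν p X)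
  refine ⟨V, ?_, c, hV⟩
  have h1 := g.mvfderiv_inner h.contMDiff_transversal h.contMDiff_transversal p X
  simp only [h.inner_self] at h1
  rw [mvfderiv_const, zero_apply, g.symm _ (g.covAlong _ _ _ _), hV, map_add, map_smul,
    h.inner_self, smul_zero, add_zero] at h1
  obtain ⟨h2, h3⟩ := screenProj_spec (hS p) V
  obtain ⟨d, hd⟩ := hf.exists_eq_smul (h.notMem_range p) (h.mem_rad p) (h.ne_zero p) h3
  have h4 : V = g.screenProj f S p V + d • ξ p := by rw [← hd]; abel
  -- `d` is the radical coefficient of `V`; pairing with `ν` detects exactly this coefficient, and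
  -- `ḡ(V,ν) = 0` by differentiating `ḡ(ν,ν) = 0`.
  have h5 : d = 0 := by
    rw [h4, map_add, map_add, h.inner_screen p _ h2, map_smul, map_smul, g.symm _ (ν p),
      h.inner_eq_one] at h1
    simp only [smul_eq_mul] at h1
    linarith
  rw [h4, h5, zero_smul, add_zero]
  exact h2

/-- A transversal field orthogonal to the screen distribution is a combination of the null frame. -/
theorem IsNullFrame.eq_smul_add_smul (hf : g.IsDegenerateHypersurface (k := k) f)
    (hS : ∀ p, IsCompl (S p) (g.rad f p)) (h : g.IsNullFrame f S ξ ν) {p : M}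
    {z : TangentSpace (𝓡 m) (f p)}
    (hz : ∀ X ∈ S p, g.inner (f p) z (mfderiv (𝓡 k) (𝓡 m) f p X) = 0) :
    z = g.inner (f p) z (ν p) • mfderiv (𝓡 k) (𝓡 m) f p (ξ p)
      + g.inner (f p) z (mfderiv (𝓡 k) (𝓡 m) f p (ξ p)) • ν p := by
  refine g.ext_inner fun W ↦ ?_
  obtain ⟨Y, c, rfl⟩ := hf.exists_add_smul (h.notMem_range p) W
  obtain ⟨h2, h3⟩ := screenProj_spec (hS p) Y
  obtain ⟨d, hd⟩ := hf.exists_eq_smul (h.notMem_range p) (h.mem_rad p) (h.ne_zero p) h3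
  have h4 : Y = g.screenProj f S p Y + d • ξ p := by rw [← hd]; abel
  have h5 := h.inner_eq_one p
  have h6 : g.inner (f p) (ν p) (mfderiv (𝓡 k) (𝓡 m) f p (ξ p)) = 1 := by rw [g.symm, h5]
  have h7 : g.inner (f p) (mfderiv (𝓡 k) (𝓡 m) f p (ξ p))
      (mfderiv (𝓡 k) (𝓡 m) f p (g.screenProj f S p Y)) = 0 := by
    rw [g.symm]; exact mem_rad_iff.1 (h.mem_rad p) _
  rw [h4]
  simp only [map_add, map_smul, add_apply, smul_apply, smul_eq_mul, h.inner_self, h5, h6, h7,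
    hz _ h2, h.inner_screen p _ h2, mem_rad_iff.1 (h.mem_rad p)]
  ring

/-- The structure equations of the decomposition `Z = a ξ + b ν` of a closed conformal field. -/
theorem IsNullFrame.structure_eq (hf : g.IsDegenerateHypersurface (k := k) f)
    (h : g.IsNullFrame f S ξ ν) {Z : ∀ x : N, TangentSpace (𝓡 m) x}
    (hZ : ContMDiff (𝓡 m) (𝓡 m).tangent ∞ (fun x ↦ (⟨x, Z x⟩ : TangentBundle (𝓡 m) N)))
    {φ : N → ℝ} (hφ : ∀ (x : N) (X : TangentSpace (𝓡 m) x), g.cov Z x X = φ x • X)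
    {a b : M → ℝ} (ha : ContMDiff (𝓡 k) 𝓘(ℝ) ∞ a) (hb : ContMDiff (𝓡 k) 𝓘(ℝ) ∞ b)
    (hab : ∀ p, Z (f p) = a p • mfderiv (𝓡 k) (𝓡 m) f p (ξ p) + b p • ν p) {p : M}
    {X U V : TangentSpace (𝓡 k) p} {c : ℝ}
    (hU : g.covAlong f (fun q ↦ mfderiv (𝓡 k) (𝓡 m) f q (ξ q)) p X =
      mfderiv (𝓡 k) (𝓡 m) f p U)
    (hV : g.covAlong f ν p X = mfderiv (𝓡 k) (𝓡 m) f p V + c • ν p) :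
    φ (f p) • X = a p • U + (mvfderiv (𝓡 k) a p X : ℝ) • ξ p + b p • V ∧
      (mvfderiv (𝓡 k) b p X : ℝ) + b p * c = 0 := by
  have hξ := smoothAlong_mfderiv hf.contMDiff h.contMDiff_rad
  have hν : SmoothAlong (k := k) f ν := h.contMDiff_transversal
  have h1 := g.covAlong_comp hf.contMDiff hZ p X
  rw [hφ, funext hab, g.covAlong_add (hξ.smul ha) (hν.smul hb), g.covAlong_smul ha hξ,
    g.covAlong_smul hb hν, hU, hV] at h1
  -- Tangential terms on one side, multiples of `ν` on the other; transversality of `ν` makes both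
  -- vanish.
  have h2 : mfderiv (𝓡 k) (𝓡 m) f p
      (φ (f p) • X - (a p • U + (mvfderiv (𝓡 k) a p X : ℝ) • ξ p + b p • V)) =
      ((mvfderiv (𝓡 k) b p X : ℝ) + b p * c) • ν p := by
    simp only [map_sub, map_add, map_smul]
    rw [← h1]
    module
  have h3 : (mvfderiv (𝓡 k) b p X : ℝ) + b p * c = 0 := by
    by_contra h3
    refine h.notMem_range p ⟨((mvfderiv (𝓡 k) b p X : ℝ) + b p * c)⁻¹ •
      (φ (f p) • X - (a p • U + (mvfderiv (𝓡 k) a p X : ℝ) • ξ p + b p • V)), ?_⟩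
    rw [map_smul, h2, smul_smul, inv_mul_cancel₀ h3, one_smul]
  refine ⟨?_, h3⟩
  rw [h3, zero_smul] at h2
  exact sub_eq_zero.1 (hf.injective p (h2.trans (map_zero _).symm))

/-- The tangential structure equation, projected to the screen, can be solved for `A_ν` because the
coefficient `b = ḡ(Z,ξ)` of `ν` in `Z` has no zeros. -/
theorem IsNullFrame.exists_shapeOp_eq (hf : g.IsDegenerateHypersurface (k := k) f)
    (hS : ∀ p, IsCompl (S p) (g.rad f p)) (h : g.IsNullFrame f S ξ ν)
    {Z : ∀ x : N, TangentSpace (𝓡 m) x} (hZ : g.IsClosedConformal Z)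
    (hZt : ∀ p : M, Z (f p) ∉ Set.range (mfderiv (𝓡 k) (𝓡 m) f p))
    (hZS : ∀ p, ∀ X ∈ S p, g.inner (f p) (Z (f p)) (mfderiv (𝓡 k) (𝓡 m) f p X) = 0) :
    ∃ φ ψ : M → ℝ, ContMDiff (𝓡 k) 𝓘(ℝ) ∞ φ ∧ ContMDiff (𝓡 k) 𝓘(ℝ) ∞ ψ ∧
      ∀ (p : M) (X : TangentSpace (𝓡 k) p),
        g.shapeOp f ν p X = φ p • g.screenShapeOp f S ν ξ p X + ψ p • g.screenProj f S p X := by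
  obtain ⟨hZs, φ, hφs, hφ⟩ := hZ
  have hξ := smoothAlong_mfderiv hf.contMDiff h.contMDiff_rad
  have hν : SmoothAlong (k := k) f ν := h.contMDiff_transversal
  have hZf : SmoothAlong (k := k) f (fun q ↦ Z (f q)) := hZs.comp hf.contMDiff
  let a (q : M) : ℝ := g.inner (f q) (Z (f q)) (ν q)
  let b (q : M) : ℝ := g.inner (f q) (Z (f q)) (mfderiv (𝓡 k) (𝓡 m) f q (ξ q))
  have ha : ContMDiff (𝓡 k) 𝓘(ℝ) ∞ a := SmoothAlong.contMDiff_inner g hZf hν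
  have hb : ContMDiff (𝓡 k) 𝓘(ℝ) ∞ b := SmoothAlong.contMDiff_inner g hZf hξ
  have hb0 (q : M) : b q ≠ 0 := by
    simp only [b]
    rw [g.symm]
    exact hf.inner_rad_ne_zero (hZt q) (h.mem_rad q) (h.ne_zero q)
  refine ⟨fun q ↦ -(a q / b q), fun q ↦ -(φ (f q) / b q), (ha.div₀ hb hb0).neg,
    ((hφs.comp hf.contMDiff).div₀ hb hb0).neg, fun p X ↦ ?_⟩
  obtain ⟨U, hU⟩ := h.exists_covAlong_rad hf p X
  obtain ⟨V, hVS, c, hV⟩ := h.exists_covAlong_transversal hf hS p X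
  obtain ⟨heq, -⟩ := h.structure_eq hf hZs hφ ha hb
    (fun q ↦ h.eq_smul_add_smul hf hS (hZS q)) hU hV
  have hinj := hf.injective p
  have hνt := h.notMem_range p
  have hshape : g.shapeOp f ν p X = -V := by
    rw [shapeOp, hV, tangentPart_add_smul hinj hνt]
  have hscreen : g.screenShapeOp f S ν ξ p X = -g.screenProj f S p U := by
    rw [screenShapeOp, inducedCov, hU, tangentPart_mfderiv hinj hνt]
  obtain ⟨hXS, hXr⟩ := screenProj_spec (hS p) X
  obtain ⟨hUS, hUr⟩ := screenProj_spec (hS p) U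
  -- The difference of the two sides lies in the screen and, by the structure equation, in the
  -- radical.
  have hproj : φ (f p) • g.screenProj f S p X = a p • g.screenProj f S p U + b p • V := by
    refine sub_eq_zero.1 (Submodule.disjoint_def.1 (hS p).disjoint _
      (Submodule.sub_mem _ (Submodule.smul_mem _ _ hXS)
        (Submodule.add_mem _ (Submodule.smul_mem _ _ hUS) (Submodule.smul_mem _ _ hVS))) ?_)
    have hr := Submodule.add_mem _ (Submodule.sub_mem _ (Submodule.smul_mem _ (a p) hUr)
      (Submodule.smul_mem _ (φ (f p)) hXr))
      (Submodule.smul_mem _ (mvfderiv (𝓡 k) a p X : ℝ) (h.mem_rad p))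
    convert hr using 1
    rw [smul_sub, smul_sub, heq]
    abel
  rw [hshape, hscreen]
  have hV' : V = (b p)⁻¹ • (φ (f p) • g.screenProj f S p X - a p • g.screenProj f S p U) := by
    rw [hproj, add_sub_cancel_left, smul_smul, inv_mul_cancel₀ (hb0 p), one_smul]
  simp only [hV', div_eq_inv_mul]
  module

/-- Here `a = 1` and `b = ḡ(Z,Z)/2`, with `X(b) = φ ḡ(X,Z) = 0`; the transversal structure equation
then kills `c`, the coefficient of `ν` in `∇̄_X ν`. -/
theorem IsNullFrame.tau_eq (hf : g.IsDegenerateHypersurface (k := k) f)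
    (hS : ∀ p, IsCompl (S p) (g.rad f p)) (h : g.IsNullFrame f S ξ ν)
    {Z : ∀ x : N, TangentSpace (𝓡 m) x} (hZ : g.IsClosedConformal Z)
    (hZ0 : ∀ x : N, g.inner x (Z x) (Z x) ≠ 0)
    (hab : ∀ p : M, Z (f p) = mfderiv (𝓡 k) (𝓡 m) f p (ξ p)
      + (g.inner (f p) (Z (f p)) (Z (f p)) / 2) • ν p) {p : M} {X : TangentSpace (𝓡 k) p}
    (hX : g.inner (f p) (Z (f p)) (mfderiv (𝓡 k) (𝓡 m) f p X) = 0) :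
    g.tau f ξ ν p X = 0 := by
  obtain ⟨hZs, φ, hφs, hφ⟩ := hZ
  have hZf : SmoothAlong (k := k) f (fun q ↦ Z (f q)) := hZs.comp hf.contMDiff
  -- The factor `1/2` sits inside one slot so that `mvfderiv_inner` differentiates `b` directly.
  have hb : ContMDiff (𝓡 k) 𝓘(ℝ) ∞ fun q ↦
      g.inner (f q) ((1 / 2 : ℝ) • Z (f q)) (Z (f q)) :=
    SmoothAlong.contMDiff_inner g (hZf.smul contMDiff_const) hZf
  obtain ⟨U, hU⟩ := h.exists_covAlong_rad hf p X
  obtain ⟨V, hVS, c, hV⟩ := h.exists_covAlong_transversal hf hS p X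
  obtain ⟨-, heq⟩ := h.structure_eq hf hZs hφ (contMDiff_const (c := (1 : ℝ))) hb
    (fun q ↦ by
      rw [one_smul, map_smul, smul_apply, smul_eq_mul, one_div_mul_eq_div]
      exact hab q) hU hV
  rw [g.mvfderiv_inner (hZf.smul contMDiff_const) hZf,
    g.covAlong_smul contMDiff_const hZf, g.covAlong_comp hf.contMDiff hZs, hφ, mvfderiv_const,
    zero_apply, zero_smul, add_zero] at heq
  simp only [map_smul, smul_apply, smul_eq_mul] at heq
  rw [g.symm _ _ (Z (f p)), hX] at heq
  have hc : c = 0 := by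
    have h1 : 1 / 2 * g.inner (f p) (Z (f p)) (Z (f p)) * c = 0 := by linarith
    exact (mul_eq_zero.1 h1).resolve_left (mul_ne_zero (by norm_num) (hZ0 _))
  rw [tau, transversalPart, hV, tangentPart_add_smul (hf.injective p) (h.notMem_range p),
    add_sub_cancel_left, hc, zero_smul, map_zero, zero_apply]

/-! ### The screen distribution and the null frame determined by `Z` -/

variable {Z : ∀ x : N, TangentSpace (𝓡 m) x}

theorem IsDegenerateHypersurface.isCompl_screenOf (hf : g.IsDegenerateHypersurface (k := k) f)
    {p : M} (hZt : Z (f p) ∉ Set.range (mfderiv (𝓡 k) (𝓡 m) f p)) :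
    IsCompl (g.screenOf (k := k) f Z p) (g.rad f p) := by
  refine IsCompl.of_eq ((Submodule.eq_bot_iff _).2 ?_) ((Submodule.eq_top_iff').2 ?_)
  · rintro X ⟨hX, hXr⟩
    by_contra h0
    refine hf.inner_rad_ne_zero hZt hXr h0 ?_
    rw [g.symm]
    exact mem_screenOf_iff.1 hX
  · intro X
    obtain ⟨η, hη, h⟩ := hf.exists_rad_inner_eq hZt
      (g.inner (f p) (Z (f p)) (mfderiv (𝓡 k) (𝓡 m) f p X))
    refine Submodule.mem_sup.2 ⟨X - η, mem_screenOf_iff.2 ?_, η, hη, sub_add_cancel _ _⟩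
    rw [map_sub, map_sub, ← h, g.symm _ (Z (f p)), sub_self]

theorem disjoint_span_map_rad {p : M} (hZt : Z (f p) ∉ Set.range (mfderiv (𝓡 k) (𝓡 m) f p)) :
    Disjoint (Submodule.span ℝ {Z (f p)})
      ((g.rad (k := k) f p).map (mfderiv (𝓡 k) (𝓡 m) f p).toLinearMap) := by
  refine Submodule.disjoint_def.2 fun W hW hW' ↦ ?_
  obtain ⟨c, rfl⟩ := Submodule.mem_span_singleton.1 hW
  obtain ⟨η, -, hη⟩ := hW'
  have hη' : mfderiv (𝓡 k) (𝓡 m) f p η = c • Z (f p) := hη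
  by_cases hc : c = 0
  · rw [hc, zero_smul]
  · refine absurd ⟨c⁻¹ • η, ?_⟩ hZt
    rw [map_smul, hη', smul_smul, inv_mul_cancel₀ hc, one_smul]

/-- A vector orthogonal to a nonzero radical vector is tangent to `M`, so no part of the orthogonal
complement is lost in `screenOf`. -/
theorem IsDegenerateHypersurface.map_screenOf (hf : g.IsDegenerateHypersurface (k := k) f)
    {p : M} (hZt : Z (f p) ∉ Set.range (mfderiv (𝓡 k) (𝓡 m) f p)) :
    (g.screenOf (k := k) f Z p).map (mfderiv (𝓡 k) (𝓡 m) f p).toLinearMap =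
      (g.form (f p)).orthogonal (g.spanSupRad (k := k) f Z p) := by
  refine le_antisymm ?_ fun W hW ↦ ?_
  · rintro _ ⟨Y, hY, rfl⟩
    exact hY
  · obtain ⟨η, hη, h0⟩ := Submodule.exists_mem_ne_zero_of_ne_bot (hf.degenerate p)
    obtain ⟨Y, rfl⟩ := hf.mem_range_of_inner_rad_eq_zero hZt hη h0
      (LinearMap.BilinForm.mem_orthogonal_iff.1 hW _
        (Submodule.mem_sup_right (Submodule.mem_map_of_mem hη)))
    exact ⟨Y, hW, rfl⟩

/-- With `ν = (Z - ξ)/θ`, `ḡ(ν,ν) = 0` amounts to `ḡ(Z,Z) = 2ḡ(Z,ξ)`, which dictates the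
normalization `ḡ(ξ,Z) = θ = ḡ(Z,Z)/2`. -/
theorem IsDegenerateHypersurface.exists_isNullFrame (hf : g.IsDegenerateHypersurface (k := k) f)
    (hZ : SmoothAlong (k := m) (id : N → N) Z) (hZ0 : ∀ x : N, g.inner x (Z x) (Z x) ≠ 0)
    (hZt : ∀ p : M, Z (f p) ∉ Set.range (mfderiv (𝓡 k) (𝓡 m) f p)) :
    ∃ (ξ : ∀ p : M, TangentSpace (𝓡 k) p) (ν : ∀ p : M, TangentSpace (𝓡 m) (f p)),
      g.IsNullFrame f (g.screenOf f Z) ξ ν ∧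
      ∀ p : M, Z (f p) = mfderiv (𝓡 k) (𝓡 m) f p (ξ p)
        + (g.inner (f p) (Z (f p)) (Z (f p)) / 2) • ν p := by
  have hZf : SmoothAlong (k := k) f (fun q ↦ Z (f q)) := fun p ↦
    ContMDiffAt.comp p (hZ (f p)) (hf.contMDiff p)
  let θ (q : M) : ℝ := g.inner (f q) (Z (f q)) (Z (f q)) / 2
  have hθ : ContMDiff (𝓡 k) 𝓘(ℝ) ∞ θ := (hZf.contMDiff_inner g hZf).div_const 2
  have hθ0 (q : M) : θ q ≠ 0 := div_ne_zero (hZ0 _) two_ne_zero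
  -- The pointwise choice does no harm: the product with `Z` determines a radical vector, and
  -- smoothness follows from that of `θ`.
  choose ξ hξr hξZ using fun p ↦ hf.exists_rad_inner_eq (hZt p) (θ p)
  have hξ : SmoothAlong (k := k) (id : M → M) ξ :=
    hf.contMDiff_of_mem_rad hZf hZt hξr (by simpa only [hξZ] using hθ)
  have hDξ := smoothAlong_mfderiv hf.contMDiff hξ
  have hrad (p : M) (X : TangentSpace (𝓡 k) p) : g.inner (f p) (mfderiv (𝓡 k) (𝓡 m) f p (ξ p))
      (mfderiv (𝓡 k) (𝓡 m) f p X) = 0 := by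
    rw [g.symm]
    exact mem_rad_iff.1 (hξr p) X
  have hZξ (p : M) : g.inner (f p) (Z (f p)) (mfderiv (𝓡 k) (𝓡 m) f p (ξ p)) = θ p := by
    rw [g.symm, hξZ]
  have hZZ (p : M) : g.inner (f p) (Z (f p)) (Z (f p)) = 2 * θ p :=
    (mul_div_cancel₀ _ two_ne_zero).symm
  refine ⟨ξ, fun q ↦ (θ q)⁻¹ • (Z (f q) + (-1 : ℝ) • mfderiv (𝓡 k) (𝓡 m) f q (ξ q)), ?_, ?_⟩
  · refine ⟨hξ, (hZf.add (hDξ.smul contMDiff_const)).smul (hθ.inv₀ hθ0), hξr, fun p h0 ↦ hθ0 p ?_,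
      fun p ↦ ?_, fun p ↦ ?_, fun p X hX ↦ ?_⟩
    · rw [← hξZ, h0, map_zero, map_zero, zero_apply]
    · simp only [map_add, map_smul, smul_eq_mul, hrad, hξZ, mul_zero, add_zero,
        inv_mul_cancel₀ (hθ0 p)]
    · simp only [map_add, map_smul, add_apply, smul_apply, smul_eq_mul, hrad, hξZ, hZξ, hZZ]
      ring
    · simp only [map_add, map_smul, add_apply, smul_apply, smul_eq_mul, hrad,
        mem_screenOf_iff.1 hX, mul_zero, add_zero]
  · intro p
    change _ = _ + θ p • (θ p)⁻¹ • (Z (f p) + (-1 : ℝ) • mfderiv (𝓡 k) (𝓡 m) f p (ξ p))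
    rw [smul_smul, mul_inv_cancel₀ (hθ0 p), one_smul, neg_one_smul]
    abel

theorem IsDegenerateHypersurface.isScreen_screenOf (hf : g.IsDegenerateHypersurface (k := k) f)
    (hZ : SmoothAlong (k := m) (id : N → N) Z) (hZ0 : ∀ x : N, g.inner x (Z x) (Z x) ≠ 0)
    (hZt : ∀ p : M, Z (f p) ∉ Set.range (mfderiv (𝓡 k) (𝓡 m) f p)) :
    g.IsScreen (k := k) f (g.screenOf f Z) := by
  obtain ⟨ξ, ν, h, -⟩ := hf.exists_isNullFrame hZ hZ0 hZt
  refine ⟨isSmoothDistribution_of_mem_iff hf.contMDiff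
    (fun p ↦ ContMDiffAt.comp p (hZ (f p)) (hf.contMDiff p)) h.contMDiff_rad (fun p ↦ ?_)
    fun p X ↦ mem_screenOf_iff, fun p ↦ hf.isCompl_screenOf (hZt p)⟩
  rw [g.symm]
  exact hf.inner_rad_ne_zero (hZt p) (h.mem_rad p) (h.ne_zero p)

end NullFrame

end LorentzianMetric

theorem mainTheorem2 (n : ℕ)
    {Mbar : Type*} [TopologicalSpace Mbar]
    [ChartedSpace (EuclideanSpace ℝ (Fin (n + 2))) Mbar] [IsManifold (𝓡 (n + 2)) ∞ Mbar]
    {M : Type*} [TopologicalSpace M]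
    [ChartedSpace (EuclideanSpace ℝ (Fin (n + 1))) M] [IsManifold (𝓡 (n + 1)) ∞ M]
    (g : LorentzianMetric (n + 2) Mbar) (f : M → Mbar)
    (hf : g.IsDegenerateHypersurface (k := n + 1) f)
    (Z : ∀ x : Mbar, TangentSpace (𝓡 (n + 2)) x)
    (hZ : g.IsClosedConformal Z)
    (hZ_nonnull : ∀ x : Mbar, g.inner x (Z x) (Z x) ≠ 0)
    (hZ_transversal : ∀ p : M,
      Z (f p) ∉ Set.range (mfderiv (𝓡 (n + 1)) (𝓡 (n + 2)) f p)) :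
    -- the sum of `span(Z)` and `rad(TM)` is direct, and its orthogonal complement is tangent to `M`
    (∀ p : M,
      Disjoint (Submodule.span ℝ {Z (f p)})
        ((g.rad (k := n + 1) f p).map (mfderiv (𝓡 (n + 1)) (𝓡 (n + 2)) f p).toLinearMap) ∧
      (g.screenOf (k := n + 1) f Z p).map (mfderiv (𝓡 (n + 1)) (𝓡 (n + 2)) f p).toLinearMap =
        (g.form (f p)).orthogonal (g.spanSupRad (k := n + 1) f Z p)) ∧
    -- it is a screen distribution, and it makes `M` screen quasi-conformal
    g.IsScreen (k := n + 1) f (g.screenOf f Z) ∧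
    g.IsScreenQuasiConformal (k := n + 1) f (g.screenOf f Z) ∧
    -- `τ` vanishes on it, for the null frame with `Z = ξ + θ ν`, `θ = ḡ(Z,Z)/2`
    ∃ (ξ : ∀ p : M, TangentSpace (𝓡 (n + 1)) p)
      (ν : ∀ p : M, TangentSpace (𝓡 (n + 2)) (f p)),
      g.IsNullFrame f (g.screenOf f Z) ξ ν ∧
      (∀ p : M, Z (f p) = mfderiv (𝓡 (n + 1)) (𝓡 (n + 2)) f p (ξ p)
        + (g.inner (f p) (Z (f p)) (Z (f p)) / 2) • ν p) ∧
      ∀ (p : M), ∀ X ∈ g.screenOf (k := n + 1) f Z p, g.tau f ξ ν p X = 0 := by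
  obtain ⟨ξ, ν, h, hab⟩ := hf.exists_isNullFrame hZ.1 hZ_nonnull hZ_transversal
  have hS := hf.isScreen_screenOf hZ.1 hZ_nonnull hZ_transversal
  exact ⟨fun p ↦ ⟨LorentzianMetric.disjoint_span_map_rad (hZ_transversal p),
      hf.map_screenOf (hZ_transversal p)⟩, hS,
    ⟨⟨ξ, ν, h⟩, fun ξ' ν' h' ↦ h'.exists_shapeOp_eq hf hS.2 hZ hZ_transversal
      fun p X hX ↦ LorentzianMetric.mem_screenOf_iff.1 hX⟩,
    ξ, ν, h, hab, fun p X hX ↦ h.tau_eq hf hS.2 hZ hZ_nonnull hab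
      (LorentzianMetric.mem_screenOf_iff.1 hX)⟩
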